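/- Let $M$ be a smooth $n$-dimensional manifold without boundary, let $\hat g$ be a smooth Riemannian metric on $M$ with Levi-Civita connection $\widehat\nabla$, and let $\hat B : TM \to TM$ be a smooth $(1,1)$-tensor that is self-adjoint with respect to $\hat g$. Put $\hat{I\!\!I}(X,Y) = \hat g(\hat B X, Y)$ and $$\widehat{Rm}(X,Y,Z,W) = \hat g\bigl(\widehat\nabla_X\widehat\nabla_Y Z - \widehat\nabla_Y\widehat\nabla_X Z - \widehat\nabla_{[X,Y]}Z,\, W\bigr),$$ $$d^{\widehat\nabla}\hat B(X,Y) = \widehat\nabla_X(\hat B Y) - \widehat\nabla_Y(\hat B X) - \hat B([X,Y]),$$ and for symmetric $2$-tensors $T,S$ let $$\mathrm{KN}(T,S)(X,Y,Z,W) = T(X,W)S(Y,Z) + T(Y,Z)S(X,W) - T(X,Z)S(Y,W) - T(Y,W)S(X,Z)$$ be their Kulkarni–Nomizu product. Suppose that $(\hat g,\hat B)$ solves the Gauss–Codazzi equations at infinity, $$\widehat{Rm} = -\tfrac12\, \mathrm{KN}(\hat g,\hat{I\!\!I}), \qquad d^{\widehat\nabla}\hat B = 0 .$$ Then $\hat g$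 is locally conformally flat: every point of $M$ lies in the domain $U$ of a smooth chart $\varphi : U \to \mathbb{R}^n$ for which there is a smooth function $u : U \to \mathbb{R}$ with $\hat g = e^{2u}\varphi^*\bar g$ on $U$, where $\bar g$ is the Euclidean metric of $\mathbb{R}^n$. -/

import Mathlib

open Bundle VectorField
open scoped Manifold ContDiff Topology

noncomputable section

namespace GCInfinity

variable {n : ℕ} {M : Type*} [TopologicalSpace M] [ChartedSpace (EuclideanSpace ℝ (Fin n)) M]
  [IsManifold (𝓡 n) ∞ M]

/-- Smooth Riemannian metrics on the smooth `n`-manifold `M`. -/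
abbrev RMetric (n : ℕ) (M : Type*) [TopologicalSpace M]
    [ChartedSpace (EuclideanSpace ℝ (Fin n)) M] [IsManifold (𝓡 n) ∞ M] :=
  ContMDiffRiemannianMetric (𝓡 n) ∞ (EuclideanSpace ℝ (Fin n))
    (fun x : M ↦ TangentSpace (𝓡 n) x)

/-- Vector fields on `M`, without any regularity. -/
abbrev VField (n : ℕ) (M : Type*) [TopologicalSpace M]
    [ChartedSpace (EuclideanSpace ℝ (Fin n)) M] :=
  Π x : M, TangentSpace (𝓡 n) x

/-- The vector field `X` is differentiable at `x`. -/
abbrev DiffAt (X : VField n M) (x : M) : Prop :=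
  MDifferentiableAt (𝓡 n) ((𝓡 n).prod 𝓘(ℝ, EuclideanSpace ℝ (Fin n)))
    (fun y ↦ TotalSpace.mk' (EuclideanSpace ℝ (Fin n)) y (X y)) x

/-- Affine connections on `M`: `cov Y x (X x)` is the value at `x` of `∇_X Y`. -/
abbrev Connection (n : ℕ) (M : Type*) [TopologicalSpace M]
    [ChartedSpace (EuclideanSpace ℝ (Fin n)) M] [IsManifold (𝓡 n) ∞ M] :=
  CovariantDerivative (𝓡 n) (EuclideanSpace ℝ (Fin n)) (fun x : M ↦ TangentSpace (𝓡 n) x)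

/-- `∇ g = 0`, that is `X g(Y, Z) = g(∇_X Y, Z) + g(Y, ∇_X Z)`; see `isCompatible_iff`. -/
def IsCompatible (g : RMetric n M) (cov : Connection n M) : Prop :=
  letI : RiemannianBundle (fun x : M ↦ TangentSpace (𝓡 n) x) := ⟨g.toRiemannianMetric⟩
  cov.IsMetricCompatible

theorem isCompatible_iff (g : RMetric n M) (cov : Connection n M) :
    IsCompatible g cov ↔ ∀ {x : M} {X Y Z : VField n M},
      DiffAt X x → DiffAt Y x → DiffAt Z x →
      mvfderiv (𝓡 n) (fun y ↦ g.inner y (Y y) (Z y)) x (X x) =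
        g.inner x (cov Y x (X x)) (Z x) + g.inner x (Y x) (cov Z x (X x)) := by
  let : RiemannianBundle (fun x : M ↦ TangentSpace (𝓡 n) x) := ⟨g.toRiemannianMetric⟩
  exact cov.isMetricCompatible_iff

/-- The right-hand side of the Koszul formula for `2 g(∇_X Y, Z)`. -/
def koszul (g : RMetric n M) (X Y Z : VField n M) (x : M) : ℝ :=
  mvfderiv (𝓡 n) (fun y ↦ g.inner y (Y y) (Z y)) x (X x) + mvfderiv (𝓡 n) (fun y ↦ g.inner y (X y) (Z y)) x (Y x)
    - mvfderiv (𝓡 n) (fun y ↦ g.inner y (X y) (Y y)) x (Z x)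
    + g.inner x (mlieBracket (𝓡 n) X Y x) (Z x) - g.inner x (mlieBracket (𝓡 n) X Z x) (Y x)
    - g.inner x (mlieBracket (𝓡 n) Y Z x) (X x)

theorem mdiffAt_inner (g : RMetric n M) {Y Z : VField n M} {x : M}
    (hY : DiffAt Y x) (hZ : DiffAt Z x) :
    MDifferentiableAt (𝓡 n) 𝓘(ℝ, ℝ) (fun y ↦ g.inner y (Y y) (Z y)) x := by
  let : RiemannianBundle (fun x : M ↦ TangentSpace (𝓡 n) x) := ⟨g.toRiemannianMetric⟩
  exact hY.inner_bundle hZ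

theorem d_add (g : RMetric n M) {X Y Z : VField n M} {x : M}
    (hX : DiffAt X x) (hY : DiffAt Y x) (hZ : DiffAt Z x) :
    mvfderiv (𝓡 n) (fun y ↦ g.inner y ((X + Y) y) (Z y)) x =
      mvfderiv (𝓡 n) (fun y ↦ g.inner y (X y) (Z y)) x + mvfderiv (𝓡 n) (fun y ↦ g.inner y (Y y) (Z y)) x := by
  rw [← mvfderiv_add (mdiffAt_inner g hX hZ) (mdiffAt_inner g hY hZ)]
  congr 1
  ext y
  simp

theorem d_smul (g : RMetric n M) {X Z : VField n M} {f : M → ℝ} {x : M}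
    (hf : MDifferentiableAt (𝓡 n) 𝓘(ℝ, ℝ) f x) (hX : DiffAt X x) (hZ : DiffAt Z x) :
    mvfderiv (𝓡 n) (fun y ↦ g.inner y ((f • X) y) (Z y)) x =
      f x • mvfderiv (𝓡 n) (fun y ↦ g.inner y (X y) (Z y)) x + g.inner x (X x) (Z x) • mvfderiv (𝓡 n) f x := by
  rw [← mvfderiv_mul hf (mdiffAt_inner g hX hZ)]
  congr 1
  ext y
  simp

theorem d_symm (g : RMetric n M) (X Z : VField n M) :
    (fun y ↦ g.inner y (X y) (Z y)) = (fun y ↦ g.inner y (Z y) (X y)) := by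
  ext y
  exact g.symm _ _ _

theorem koszul_tensorial₁ (g : RMetric n M) {Y Z : VField n M} {x : M}
    (hY : DiffAt Y x) (hZ : DiffAt Z x) :
    TensorialAt (𝓡 n) (EuclideanSpace ℝ (Fin n)) (fun X ↦ koszul g X Y Z x) x where
  smul {f X} hf hX := by
    simp only [koszul, d_smul g hf hX hZ, d_smul g hf hX hY, mlieBracket_smul_left hf hX]
    simp
    ring
  add {X X'} hX hX' := by
    simp only [koszul, d_add g hX hX' hZ, d_add g hX hX' hY, mlieBracket_add_left hX hX']
    simp
    ring

theorem koszul_tensorial₃ (g : RMetric n M) {X Y : VField n M} {x : M}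
    (hX : DiffAt X x) (hY : DiffAt Y x) :
    TensorialAt (𝓡 n) (EuclideanSpace ℝ (Fin n)) (fun Z ↦ koszul g X Y Z x) x where
  smul {f Z} hf hZ := by
    simp only [koszul, d_symm g Y, d_symm g X (f • Z), d_symm g X Z, d_smul g hf hZ hX,
      d_smul g hf hZ hY, mlieBracket_smul_right hf hZ]
    simp
    ring
  add {Z Z'} hZ hZ' := by
    simp only [koszul, d_symm g Y, d_symm g X (Z + Z'), d_symm g X Z, d_symm g X Z',
      d_add g hZ hZ' hX, d_add g hZ hZ' hY, mlieBracket_add_right hZ hZ']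
    simp
    ring

theorem koszul_add₂ (g : RMetric n M) {X Y Y' Z : VField n M} {x : M}
    (hX : DiffAt X x) (hY : DiffAt Y x) (hY' : DiffAt Y' x)
    (hZ : DiffAt Z x) :
    koszul g X (Y + Y') Z x = koszul g X Y Z x + koszul g X Y' Z x := by
  simp only [koszul, d_symm g X (Y + Y'), d_symm g X Y, d_symm g X Y',
    d_add g hY hY' hX, d_add g hY hY' hZ, mlieBracket_add_right hY hY', mlieBracket_add_left hY hY']
  simp
  ring

theorem koszul_smul₂ (g : RMetric n M) {X Y Z : VField n M} {f : M → ℝ} {x : M}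
    (hf : MDifferentiableAt (𝓡 n) 𝓘(ℝ, ℝ) f x)
    (hX : DiffAt X x) (hY : DiffAt Y x) (hZ : DiffAt Z x) :
    koszul g X (f • Y) Z x =
      f x * koszul g X Y Z x + 2 * (mvfderiv (𝓡 n) f x (X x) * g.inner x (Y x) (Z x)) := by
  simp only [koszul, d_symm g X (f • Y), d_symm g X Y,
    d_smul g hf hY hX, d_smul g hf hY hZ, mlieBracket_smul_right hf hY, mlieBracket_smul_left hf hY]
  simp
  ring

theorem koszul_sub (g : RMetric n M) (X Y Z : VField n M) (x : M) :
    koszul g X Y Z x - koszul g Y X Z x = 2 * g.inner x (mlieBracket (𝓡 n) X Y x) (Z x) := by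
  simp only [koszul, d_symm g Y X, mlieBracket_swap_apply (V := Y) (W := X)]
  simp
  ring

theorem koszul_add (g : RMetric n M) (X Y Z : VField n M) (x : M) :
    koszul g X Y Z x + koszul g X Z Y x = 2 * mvfderiv (𝓡 n) (fun y ↦ g.inner y (Y y) (Z y)) x (X x) := by
  simp only [koszul, d_symm g Z Y, mlieBracket_swap_apply (V := Z) (W := Y)]
  simp
  ring

theorem exists_sharp (g : RMetric n M) (x : M) :
    ∃ S : (TangentSpace (𝓡 n) x →L[ℝ] ℝ) →L[ℝ] TangentSpace (𝓡 n) x,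
      ∀ L v, g.inner x (S L) v = L v := by
  have : FiniteDimensional ℝ (TangentSpace (𝓡 n) x) :=
    inferInstanceAs (FiniteDimensional ℝ (EuclideanSpace ℝ (Fin n)))
  have : T2Space (TangentSpace (𝓡 n) x) :=
    inferInstanceAs (T2Space (EuclideanSpace ℝ (Fin n)))
  have hinj : Function.Injective (g.inner x).toLinearMap := by
    rw [injective_iff_map_eq_zero]
    intro v hv
    by_contra h
    have := g.pos x v h
    have h2 : g.inner x v = 0 := hv
    simp [h2] at this
  have hdim : Module.finrank ℝ (TangentSpace (𝓡 n) x) =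
      Module.finrank ℝ (TangentSpace (𝓡 n) x →L[ℝ] ℝ) := by
    rw [← (LinearMap.toContinuousLinearMap (𝕜 := ℝ) (E := TangentSpace (𝓡 n) x)
      (F' := ℝ)).finrank_eq]
    exact (Subspace.dual_finrank_eq).symm
  let e := LinearMap.linearEquivOfInjective _ hinj hdim
  refine ⟨LinearMap.toContinuousLinearMap e.symm.toLinearMap, fun L v ↦ ?_⟩
  have : (g.inner x).toLinearMap (e.symm L) = L := e.apply_symm_apply L
  exact congrArg (fun T : TangentSpace (𝓡 n) x →L[ℝ] ℝ ↦ T v) this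

/-- The musical isomorphism `g⁻¹ : T*M → TM`. -/
def sharp (g : RMetric n M) (x : M) :
    (TangentSpace (𝓡 n) x →L[ℝ] ℝ) →L[ℝ] TangentSpace (𝓡 n) x :=
  (exists_sharp g x).choose

theorem inner_sharp (g : RMetric n M) (x : M) (L : TangentSpace (𝓡 n) x →L[ℝ] ℝ)
    (v : TangentSpace (𝓡 n) x) : g.inner x (sharp g x L) v = L v :=
  (exists_sharp g x).choose_spec L v

theorem ext_inner (g : RMetric n M) {x : M} {a b : TangentSpace (𝓡 n) x}
    (h : ∀ v, g.inner x a v = g.inner x b v) : a = b := by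
  by_contra hab
  have := g.pos x (a - b) (sub_ne_zero.mpr hab)
  rw [map_sub] at this
  simp [h] at this

open Classical in
/-- The Levi-Civita connection as a bare operator: for `Y` differentiable at `x`, the vector
`∇_X Y (x)` is determined by the Koszul formula (see `inner_leviCivitaFun`); otherwise it is `0`. -/
def leviCivitaFun (g : RMetric n M) (Y : VField n M) (x : M) :
    TangentSpace (𝓡 n) x →L[ℝ] TangentSpace (𝓡 n) x :=
  if hY : DiffAt Y x then
    (2⁻¹ : ℝ) • (sharp g x).comp
      (TensorialAt.mkHom₂ (I := 𝓡 n) (F := EuclideanSpace ℝ (Fin n))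
        (F' := EuclideanSpace ℝ (Fin n)) (fun X Z ↦ koszul g X Y Z x) x
        (fun _ hZ ↦ koszul_tensorial₁ g hY hZ) (fun _ hX ↦ koszul_tensorial₃ g hX hY))
  else 0

theorem inner_leviCivitaFun (g : RMetric n M) {X Y Z : VField n M} {x : M}
    (hX : DiffAt X x) (hY : DiffAt Y x) (hZ : DiffAt Z x) :
    g.inner x (leviCivitaFun g Y x (X x)) (Z x) = 2⁻¹ * koszul g X Y Z x := by
  rw [leviCivitaFun, dif_pos hY]
  simp only [smul_apply, ContinuousLinearMap.comp_apply, map_smul,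
    inner_sharp, smul_eq_mul]
  rw [TensorialAt.mkHom₂_apply _ _ hX hZ]

theorem ext_fields (g : RMetric n M) {x : M}
    {A B : TangentSpace (𝓡 n) x →L[ℝ] TangentSpace (𝓡 n) x}
    (h : ∀ X Z : VField n M, DiffAt X x → DiffAt Z x →
      g.inner x (A (X x)) (Z x) = g.inner x (B (X x)) (Z x)) : A = B := by
  ext1 v
  refine ext_inner g fun w ↦ ?_
  have := h (FiberBundle.extend (EuclideanSpace ℝ (Fin n)) v)
    (FiberBundle.extend (EuclideanSpace ℝ (Fin n)) w) (FiberBundle.mdifferentiableAt_extend ..)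
    (FiberBundle.mdifferentiableAt_extend ..)
  simpa using this

/-- The Levi-Civita connection of `g`: torsion-free (`leviCivita_torsion`) and compatible with `g`
(`leviCivita_isCompatible`). -/
def leviCivita (g : RMetric n M) : Connection n M where
  toFun := leviCivitaFun g
  isCovariantDerivativeOnUniv :=
    { add := by
        intro Y Y' x hY hY' _
        refine ext_fields g fun X Z hX hZ ↦ ?_
        have hYY := mdifferentiableAt_add_section hY hY'
        simp only [add_apply, map_add]
        rw [inner_leviCivitaFun g hX hYY hZ, inner_leviCivitaFun g hX hY hZ,
          inner_leviCivitaFun g hX hY' hZ, koszul_add₂ g hX hY hY' hZ]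
        ring
      leibniz := by
        intro Y f x hY hf _
        refine ext_fields g fun X Z hX hZ ↦ ?_
        have hfY := hf.smul_section hY
        simp only [add_apply, map_add, smul_apply,
          ContinuousLinearMap.smulRight_apply, map_smul, smul_eq_mul]
        rw [inner_leviCivitaFun g hX hfY hZ, inner_leviCivitaFun g hX hY hZ,
          koszul_smul₂ g hf hX hY hZ]
        ring }

theorem leviCivita_torsion (g : RMetric n M) : (leviCivita g).torsion = 0 := by
  rw [CovariantDerivative.torsion_eq_zero_iff]
  intro X Y x hX hY
  refine ext_inner g fun w ↦ ?_
  set Z := FiberBundle.extend (EuclideanSpace ℝ (Fin n)) w with hZd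
  have hZ : DiffAt Z x := FiberBundle.mdifferentiableAt_extend ..
  have hw : w = Z x := by simp [hZd]
  have h1 := inner_leviCivitaFun g hX hY hZ
  have h2 := inner_leviCivitaFun g hY hX hZ
  have h3 := koszul_sub g X Y Z x
  rw [hw]
  change g.inner x (leviCivitaFun g Y x (X x) - leviCivitaFun g X x (Y x)) (Z x) = _
  rw [map_sub, sub_apply]
  linarith

theorem leviCivita_isCompatible (g : RMetric n M) : IsCompatible g (leviCivita g) := by
  rw [isCompatible_iff]
  intro x X Y Z hX hY hZ
  have h1 := inner_leviCivitaFun g hX hY hZ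
  have h2 := inner_leviCivitaFun g hX hZ hY
  have h3 := koszul_add g X Y Z x
  rw [g.symm x (Y x)]
  change _ = g.inner x (leviCivitaFun g Y x (X x)) (Z x) +
    g.inner x (leviCivitaFun g Z x (X x)) (Y x)
  linarith

/-- The vector field `X` is `C^∞` at `x` (so `C^k` near `x` for every finite `k`). -/
def SmoothAt (X : VField n M) (x : M) : Prop :=
  ContMDiffAt (𝓡 n) ((𝓡 n).prod 𝓘(ℝ, EuclideanSpace ℝ (Fin n))) ∞
    (fun y ↦ TotalSpace.mk' (EuclideanSpace ℝ (Fin n)) y (X y)) x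

/-- Fields of endomorphisms of the tangent bundle, without any regularity. -/
abbrev EndField (n : ℕ) (M : Type*) [TopologicalSpace M]
    [ChartedSpace (EuclideanSpace ℝ (Fin n)) M] :=
  Π x : M, TangentSpace (𝓡 n) x →L[ℝ] TangentSpace (𝓡 n) x

/-- `B` is a smooth `(1,1)`-tensor. -/
def EndField.IsSmooth (B : EndField n M) : Prop :=
  ContMDiff (𝓡 n)
    ((𝓡 n).prod 𝓘(ℝ, EuclideanSpace ℝ (Fin n) →L[ℝ] EuclideanSpace ℝ (Fin n))) ∞
    (fun x ↦ TotalSpace.mk' (EuclideanSpace ℝ (Fin n) →L[ℝ] EuclideanSpace ℝ (Fin n))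
      (E := fun y : M ↦ TangentSpace (𝓡 n) y →L[ℝ] TangentSpace (𝓡 n) y) x (B x))

/-- `B` is self-adjoint with respect to `g`. -/
def EndField.IsSelfAdjoint (g : RMetric n M) (B : EndField n M) : Prop :=
  ∀ (x : M) (v w : TangentSpace (𝓡 n) x), g.inner x (B x v) w = g.inner x v (B x w)

/-- The vector field `∇_X Y`. -/
def nabla (cov : Connection n M) (X Y : VField n M) : VField n M :=
  fun x ↦ cov Y x (X x)

/-- `R(X,Y)Z = ∇_X ∇_Y Z - ∇_Y ∇_X Z - ∇_[X,Y] Z`. -/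
def curvature (cov : Connection n M) (X Y Z : VField n M) : VField n M :=
  nabla cov X (nabla cov Y Z) - nabla cov Y (nabla cov X Z)
    - nabla cov (mlieBracket (𝓡 n) X Y) Z

/-- The full curvature tensor `Rm(X,Y,Z,W) = g(R(X,Y)Z, W)` of the Levi-Civita connection. -/
def Rm (g : RMetric n M) (X Y Z W : VField n M) (x : M) : ℝ :=
  g.inner x (curvature (leviCivita g) X Y Z x) (W x)

/-- The vector field `B X`. -/
def EndField.app (B : EndField n M) (X : VField n M) : VField n M :=
  fun x ↦ B x (X x)

/-- The exterior covariant derivative `(d^∇ B)(X,Y) = ∇_X (B Y) - ∇_Y (B X) - B [X,Y]`. -/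
def extCovDeriv (cov : Connection n M) (B : EndField n M) (X Y : VField n M) : VField n M :=
  nabla cov X (B.app Y) - nabla cov Y (B.app X) - B.app (mlieBracket (𝓡 n) X Y)

/-- The Kulkarni-Nomizu product of two bilinear forms. -/
def kulkarniNomizu {V : Type*} [AddCommGroup V] [Module ℝ V] [TopologicalSpace V]
    (T S : V →L[ℝ] V →L[ℝ] ℝ) (a b c d : V) : ℝ :=
  T a d * S b c + T b c * S a d - T a c * S b d - T b d * S a c

/-- The second fundamental form `II(v,w) = g(Bv, w)` of the pair `(g, B)`. -/
def secondForm (g : RMetric n M) (B : EndField n M) (x : M) :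
    TangentSpace (𝓡 n) x →L[ℝ] TangentSpace (𝓡 n) x →L[ℝ] ℝ :=
  (g.inner x).comp (B x)

/-- The Gauss-Codazzi equations at infinity for the pair `(g, B)`:
`Rm(g) = -(1/2) g ∧ II` (Kulkarni-Nomizu product) and `d^∇ B = 0`, as identities of tensors,
tested on locally defined smooth vector fields. -/
structure SolvesGaussCodazziAtInfinity (g : RMetric n M) (B : EndField n M) : Prop where
  gauss : ∀ (x : M) (X Y Z W : VField n M),
    SmoothAt X x → SmoothAt Y x → SmoothAt Z x → SmoothAt W x →
    Rm g X Y Z W x =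
      -(1 / 2) * kulkarniNomizu (g.inner x) (secondForm g B x) (X x) (Y x) (Z x) (W x)
  codazzi : ∀ (x : M) (X Y : VField n M), SmoothAt X x → SmoothAt Y x →
    extCovDeriv (leviCivita g) B X Y x = 0

/-- The pullback `φ^* ḡ` of the Euclidean metric under `φ : M → ℝⁿ`. -/
def pullbackEuclidean (φ : M → EuclideanSpace ℝ (Fin n)) (x : M)
    (v w : TangentSpace (𝓡 n) x) : ℝ :=
  let dφ : TangentSpace (𝓡 n) x →L[ℝ] EuclideanSpace ℝ (Fin n) :=
    mfderiv (𝓡 n) 𝓘(ℝ, EuclideanSpace ℝ (Fin n)) φ x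
  inner ℝ (dφ v) (dφ w)

/-- `g` is locally conformally flat: around each point there is a smooth chart `φ` to `ℝⁿ` and a
smooth function `u` on its domain with `g = e^{2u} φ^* ḡ` there. -/
def IsLocallyConformallyFlat (g : RMetric n M) : Prop :=
  ∀ p : M, ∃ φ ∈ IsManifold.maximalAtlas (𝓡 n) ∞ M, p ∈ φ.source ∧
    ∃ u : M → ℝ, ContMDiffOn (𝓡 n) 𝓘(ℝ, ℝ) ∞ u φ.source ∧
      ∀ x ∈ φ.source, ∀ v w : TangentSpace (𝓡 n) x,
        g.inner x v w = Real.exp (2 * u x) * pullbackEuclidean φ x v w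

end GCInfinity
end

noncomputable section

set_option maxSynthPendingDepth 3

namespace GCInfinity

section Frobenius

open Set Metric

variable {E V : Type*} [NormedAddCommGroup E] [NormedSpace ℝ E]
  [NormedAddCommGroup V] [NormedSpace ℝ V]

theorem norm_le_two_mul_of_norm_deriv_le {f f' : ℝ → V} {ε : ℝ} (hε : 0 ≤ ε)
    (hf : ∀ t ∈ Icc (0 : ℝ) 1, HasDerivWithinAt f (f' t) (Icc 0 1) t) (h0 : f 0 = 0)
    (bound : ∀ t ∈ Icc (0 : ℝ) 1, ‖f' t‖ ≤ 2⁻¹ * ‖f t‖ + ε) :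
    ∀ t ∈ Icc (0 : ℝ) 1, ‖f t‖ ≤ 2 * ε := by
  intro t ht
  have h := norm_le_gronwallBound_of_norm_deriv_right_le (δ := 0) (K := 2⁻¹) (ε := ε)
    (fun t ht ↦ (hf t ht).continuousWithinAt)
    (fun t ht ↦ (hf t (Ico_subset_Icc_self ht)).mono_of_mem_nhdsWithin
      (Icc_mem_nhdsGE_of_mem ht)) (by simp [h0])
    (fun t ht ↦ bound t (Ico_subset_Icc_self ht)) t ht
  refine h.trans ?_
  rw [gronwallBound_of_K_ne_0 (by norm_num)]
  have h1 : Real.exp (2⁻¹ * (t - 0)) ≤ 2 := by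
    have h2 : Real.exp (2⁻¹ * (t - 0)) ≤ Real.exp 2⁻¹ := by
      apply Real.exp_le_exp.mpr
      linarith [ht.2]
    have h3 : Real.exp 2⁻¹ * Real.exp 2⁻¹ = Real.exp 1 := by
      rw [← Real.exp_add]; norm_num
    have h4 := Real.exp_one_lt_d9
    nlinarith [Real.exp_pos (2⁻¹ : ℝ)]
  have : ε / 2⁻¹ = 2 * ε := by field_simp
  rw [this]
  nlinarith

/-- A linear ordinary differential equation with small coefficients has solutions on `[0, 1]`. -/
theorem exists_linear_ode_solution [CompleteSpace V] {L : ℝ → V →L[ℝ] V}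
    (hL : ContinuousOn L (Icc 0 1)) (hb : ∀ t ∈ Icc (0 : ℝ) 1, ‖L t‖ ≤ 2⁻¹) (y : V) :
    ∃ α : ℝ → V, α 0 = y ∧
      ∀ t ∈ Icc (0 : ℝ) 1, HasDerivWithinAt α (L t (α t)) (Icc 0 1) t := by
  have hp : IsPicardLindelof (fun t z ↦ L t z) (⟨0, by simp⟩ : Icc (0 : ℝ) 1) y ‖y‖₊ 0
      ‖y‖₊ 2⁻¹ := by
    refine ⟨fun t ht ↦ ?_, fun z _ ↦ ?_, fun t ht z hz ↦ ?_, by simp⟩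
    · refine ((L t).lipschitz.weaken ?_).lipschitzOnWith
      rw [← NNReal.coe_le_coe]
      simpa using hb t ht
    · exact hL.clm_apply continuousOn_const
    · refine ((L t).le_opNorm z).trans ?_
      have h1 : ‖z‖ ≤ 2 * ‖y‖ := by
        have := norm_le_norm_add_norm_sub' z y
        have h2 : ‖z - y‖ ≤ ‖y‖ := by simpa [mem_closedBall, dist_eq_norm] using hz
        have h3 : ‖z‖ ≤ ‖y‖ + ‖z - y‖ := this
        linarith
      have := mul_le_mul (hb t ht) h1 (norm_nonneg _) (by norm_num)
      simpa using this.trans (by linarith : (2⁻¹ : ℝ) * (2 * ‖y‖) ≤ ‖y‖)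
  exact hp.exists_eq_forall_mem_Icc_hasDerivWithinAt₀

/-- Quantitative form of the Frobenius theorem for flat linear systems. -/
theorem exists_parallel_of_bounds [CompleteSpace V] {A : E → E →L[ℝ] V →L[ℝ] V}
    {A' : E → E →L[ℝ] E →L[ℝ] V →L[ℝ] V} {r C : ℝ} (hr : 0 < r) (hC : 0 ≤ C)
    (hA : ∀ x ∈ ball (0 : E) r, HasFDerivAt A (A' x) x)
    (hbA : ∀ x ∈ ball (0 : E) r, ‖A x‖ ≤ C) (hbA' : ∀ x ∈ ball (0 : E) r, ‖A' x‖ ≤ C)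
    (htaylor : ∀ x ∈ ball (0 : E) r, ∀ z ∈ ball (0 : E) r,
      ‖A z - A x - A' x (z - x)‖ ≤ C * ‖z - x‖ ^ 2)
    (hflat : ∀ x ∈ ball (0 : E) r, ∀ (c d : E) (y : V),
      A' x c d y + A x d (A x c y) = A' x d c y + A x c (A x d y))
    (hCr : C * r ≤ 2⁻¹) (y : V) :
    ∃ Φ : E → V, Φ 0 = y ∧ ∀ x ∈ ball (0 : E) r, HasFDerivAt Φ ((A x).flip (Φ x)) x := by
  have hseg : ∀ v ∈ ball (0 : E) r, ∀ t ∈ Icc (0 : ℝ) 1, t • v ∈ ball (0 : E) r := by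
    intro v hv t ht
    rw [mem_ball_zero_iff] at hv ⊢
    rw [norm_smul, Real.norm_of_nonneg ht.1]
    exact (mul_le_of_le_one_left (norm_nonneg _) ht.2).trans_lt hv
  have hcoef : ∀ v ∈ ball (0 : E) r, ∀ t ∈ Icc (0 : ℝ) 1, ‖A (t • v) v‖ ≤ 2⁻¹ := by
    intro v hv t ht
    refine ((A (t • v)).le_opNorm v).trans (le_trans ?_ hCr)
    rw [mem_ball_zero_iff] at hv
    exact mul_le_mul (hbA _ (hseg v (by simpa using hv) t ht)) hv.le (norm_nonneg _) hC
  have hex : ∀ v ∈ ball (0 : E) r, ∃ α : ℝ → V, α 0 = y ∧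
      ∀ t ∈ Icc (0 : ℝ) 1, HasDerivWithinAt α (A (t • v) v (α t)) (Icc 0 1) t := by
    intro v hv
    refine exists_linear_ode_solution (L := fun t ↦ A (t • v) v) ?_ (hcoef v hv) y
    intro t ht
    have h1 : ContinuousAt A (t • v) := (hA _ (hseg v hv t ht)).continuousAt
    have h2 : ContinuousAt (fun t : ℝ ↦ t • v) t := by fun_prop
    exact ((h1.comp (f := fun t : ℝ ↦ t • v) h2).clm_apply
      continuousAt_const).continuousWithinAt
  choose! α hα0 hα using hex
  have hαy : ∀ v ∈ ball (0 : E) r, ∀ t ∈ Icc (0 : ℝ) 1, ‖α v t - y‖ ≤ ‖y‖ := by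
    intro v hv t ht
    have := norm_le_two_mul_of_norm_deriv_le (f := fun t ↦ α v t - y)
      (f' := fun t ↦ A (t • v) v (α v t)) (ε := 2⁻¹ * ‖y‖) (by positivity)
      (fun t ht ↦ (hα v hv t ht).sub_const y) (by simp [hα0 v hv]) ?_ t ht
    · linarith
    · intro t ht
      have h1 := (A (t • v) v).le_of_opNorm_le (hcoef v hv t ht) (α v t)
      have h2 : ‖α v t‖ ≤ ‖y‖ + ‖α v t - y‖ := norm_le_norm_add_norm_sub' _ _
      linarith
  have hαN : ∀ v ∈ ball (0 : E) r, ∀ t ∈ Icc (0 : ℝ) 1, ‖α v t‖ ≤ 2 * ‖y‖ := by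
    intro v hv t ht
    have h2 : ‖α v t‖ ≤ ‖y‖ + ‖α v t - y‖ := norm_le_norm_add_norm_sub' _ _
    linarith [hαy v hv t ht]
  set N := 2 * ‖y‖ with hN
  have hN0 : 0 ≤ N := by positivity
  have happ : ∀ x ∈ ball (0 : E) r, ∀ (c : E) (z : V), ‖A x c z‖ ≤ C * ‖c‖ * ‖z‖ :=
    fun x hx c z ↦ ((A x).le_opNorm₂ c z).trans (by gcongr; exact hbA x hx)
  have happ' : ∀ x ∈ ball (0 : E) r, ∀ (c d : E) (z : V), ‖A' x c d z‖ ≤ C * ‖c‖ * ‖d‖ * ‖z‖ := by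
    intro x hx c d z
    refine ((A' x c).le_opNorm₂ d z).trans ?_
    gcongr
    exact (A' x).le_of_opNorm_le (hbA' x hx) c
  have htay : ∀ x ∈ ball (0 : E) r, ∀ z ∈ ball (0 : E) r, ∀ (c : E) (w : V),
      ‖A z c w - A x c w - A' x (z - x) c w‖ ≤ C * ‖z - x‖ ^ 2 * ‖c‖ * ‖w‖ := by
    intro x hx z hz c w
    have := ((A z - A x - A' x (z - x)).le_opNorm₂ c w)
    refine (this.trans (by gcongr; exact htaylor x hx z hz))
  refine ⟨fun v ↦ α v 1, ?_, fun v hv ↦ ?_⟩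
  · have h0 : (0 : E) ∈ ball (0 : E) r := mem_ball_self hr
    have := norm_le_two_mul_of_norm_deriv_le (f := fun t ↦ α 0 t - y)
      (f' := fun t ↦ A (t • (0 : E)) 0 (α 0 t)) (ε := 0) le_rfl
      (fun t ht ↦ (hα 0 h0 t ht).sub_const y) (by simp [hα0 0 h0])
      (by intro t ht; simp) 1 (by simp)
    have h2 : ‖α 0 1 - y‖ = 0 := le_antisymm (by simpa using this) (norm_nonneg _)
    exact sub_eq_zero.mp (norm_eq_zero.mp h2)
  -- the difference of two solutions along neighbouring rays
  set C₁ := C * r * r * N + C * r * N + C * N with hC₁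
  have hC₁0 : 0 ≤ C₁ := by positivity
  have hlip : ∀ h : E, v + h ∈ ball (0 : E) r → ‖h‖ ≤ r → ∀ t ∈ Icc (0 : ℝ) 1,
      ‖α (v + h) t - α v t‖ ≤ 2 * (C₁ * ‖h‖) := by
    intro h hvh hhr
    refine norm_le_two_mul_of_norm_deriv_le (f := fun t ↦ α (v + h) t - α v t)
      (f' := fun t ↦ A (t • (v + h)) (v + h) (α (v + h) t) - A (t • v) v (α v t))
      (by positivity) (fun t ht ↦ (hα _ hvh t ht).sub (hα v hv t ht))
      (by simp [hα0 _ hvh, hα0 v hv]) fun t ht ↦ ?_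
    have e : A (t • (v + h)) (v + h) (α (v + h) t) - A (t • v) v (α v t) =
        A (t • v) v (α (v + h) t - α v t)
        + (A (t • (v + h)) (v + h) (α (v + h) t) - A (t • v) (v + h) (α (v + h) t)
            - A' (t • v) (t • (v + h) - t • v) (v + h) (α (v + h) t))
        + A' (t • v) (t • (v + h) - t • v) (v + h) (α (v + h) t)
        + A (t • v) h (α (v + h) t) := by
      simp only [map_add, map_sub, add_apply]
      abel
    have hth : t • (v + h) - t • v = t • h := by rw [smul_add]; abel
    have hthn : ‖t • h‖ ≤ ‖h‖ := by
      rw [norm_smul, Real.norm_of_nonneg ht.1]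
      exact mul_le_of_le_one_left (norm_nonneg _) ht.2
    have hvh' : ‖v + h‖ ≤ r := (mem_ball_zero_iff.mp hvh).le
    have b1 := (A (t • v) v).le_of_opNorm_le (hcoef v hv t ht) (α (v + h) t - α v t)
    have b2 := htay _ (hseg v hv t ht) _ (hseg _ hvh t ht) (v + h) (α (v + h) t)
    have b3 := happ' _ (hseg v hv t ht) (t • (v + h) - t • v) (v + h) (α (v + h) t)
    have b4 := happ _ (hseg v hv t ht) h (α (v + h) t)
    rw [hth] at b2 b3 e
    have hn := hαN _ hvh t ht
    have b2' : C * ‖t • h‖ ^ 2 * ‖v + h‖ * ‖α (v + h) t‖ ≤ C * (r * ‖h‖) * r * N := by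
      have : ‖t • h‖ ^ 2 ≤ r * ‖h‖ := by
        rw [pow_two]
        exact mul_le_mul (hthn.trans hhr) hthn (norm_nonneg _) hr.le
      gcongr
    have b3' : C * ‖t • h‖ * ‖v + h‖ * ‖α (v + h) t‖ ≤ C * ‖h‖ * r * N := by gcongr
    have b4' : C * ‖h‖ * ‖α (v + h) t‖ ≤ C * ‖h‖ * N := by gcongr
    rw [e]
    refine (norm_add_le _ _).trans ?_
    refine (add_le_add_left (norm_add_le _ _) _).trans ?_
    refine (add_le_add_left (add_le_add_left (norm_add_le _ _) _) _).trans ?_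
    have hlast : C₁ * ‖h‖ = C * (r * ‖h‖) * r * N + C * ‖h‖ * r * N + C * ‖h‖ * N := by
      rw [hC₁]; ring
    linarith
  set D := C * r * N + C * N + C * r * (2 * C₁) + C * (2 * C₁) with hD
  have hD0 : 0 ≤ D := by positivity
  have hquad : ∀ h : E, v + h ∈ ball (0 : E) r → ‖h‖ ≤ r →
      ‖α (v + h) 1 - α v 1 - A v h (α v 1)‖ ≤ 2 * (D * ‖h‖ ^ 2) := by
    intro h hvh hhr
    have key := norm_le_two_mul_of_norm_deriv_le
      (f := fun t ↦ α (v + h) t - α v t - A (t • v) (t • h) (α v t))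
      (f' := fun t ↦ A (t • (v + h)) (v + h) (α (v + h) t) - A (t • v) v (α v t)
        - (A' (t • v) v (t • h) (α v t) + A (t • v) h (α v t)
          + A (t • v) (t • h) (A (t • v) v (α v t)))) (ε := D * ‖h‖ ^ 2)
      (by positivity) (fun t ht ↦ ?_) (by simp [hα0 _ hvh, hα0 v hv]) (fun t ht ↦ ?_) 1 (by simp)
    · simpa using key
    · refine ((hα _ hvh t ht).sub (hα v hv t ht)).sub ?_
      have d1 : HasDerivWithinAt (fun t : ℝ ↦ t • v) v (Icc 0 1) t := by
        simpa using ((hasDerivAt_id t).smul_const v).hasDerivWithinAt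
      have d2 : HasDerivWithinAt (fun t : ℝ ↦ t • h) h (Icc 0 1) t := by
        simpa using ((hasDerivAt_id t).smul_const h).hasDerivWithinAt
      have d3 := (hA _ (hseg v hv t ht)).comp_hasDerivWithinAt t d1
      have d4 := (d3.clm_apply d2).clm_apply (hα v hv t ht)
      exact d4
    · have hth : t • (v + h) - t • v = t • h := by rw [smul_add]; abel
      have hthn : ‖t • h‖ ≤ ‖h‖ := by
        rw [norm_smul, Real.norm_of_nonneg ht.1]
        exact mul_le_of_le_one_left (norm_nonneg _) ht.2
      have hvh' : ‖v + h‖ ≤ r := (mem_ball_zero_iff.mp hvh).le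
      have hv' : ‖v‖ ≤ r := (mem_ball_zero_iff.mp hv).le
      have hfl := hflat _ (hseg v hv t ht) v (t • h) (α v t)
      have e : A (t • (v + h)) (v + h) (α (v + h) t) - A (t • v) v (α v t)
        - (A' (t • v) v (t • h) (α v t) + A (t • v) h (α v t)
          + A (t • v) (t • h) (A (t • v) v (α v t))) =
          A (t • v) v (α (v + h) t - α v t - A (t • v) (t • h) (α v t))
          + (A (t • (v + h)) (v + h) (α (v + h) t) - A (t • v) (v + h) (α (v + h) t)
            - A' (t • v) (t • (v + h) - t • v) (v + h) (α (v + h) t))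
          + A' (t • v) (t • h) h (α (v + h) t)
          + A' (t • v) (t • h) v (α (v + h) t - α v t)
          + A (t • v) h (α (v + h) t - α v t) := by
        have : A' (t • v) v (t • h) (α v t) = A' (t • v) (t • h) v (α v t)
          + A (t • v) v (A (t • v) (t • h) (α v t))
          - A (t • v) (t • h) (A (t • v) v (α v t)) := by rw [← hfl]; abel
        rw [this, hth]
        simp only [map_add, map_sub, add_apply]
        abel
      have b1 := (A (t • v) v).le_of_opNorm_le (hcoef v hv t ht)
        (α (v + h) t - α v t - A (t • v) (t • h) (α v t))
      have b2 := htay _ (hseg v hv t ht) _ (hseg _ hvh t ht) (v + h) (α (v + h) t)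
      have b3 := happ' _ (hseg v hv t ht) (t • h) h (α (v + h) t)
      have b4 := happ' _ (hseg v hv t ht) (t • h) v (α (v + h) t - α v t)
      have b5 := happ _ (hseg v hv t ht) h (α (v + h) t - α v t)
      rw [hth] at b2 e
      have hn := hαN _ hvh t ht
      have hl := hlip h hvh hhr t ht
      have b2' : C * ‖t • h‖ ^ 2 * ‖v + h‖ * ‖α (v + h) t‖ ≤ C * ‖h‖ ^ 2 * r * N := by gcongr
      have b3' : C * ‖t • h‖ * ‖h‖ * ‖α (v + h) t‖ ≤ C * ‖h‖ * ‖h‖ * N := by gcongr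
      have b4' : C * ‖t • h‖ * ‖v‖ * ‖α (v + h) t - α v t‖
          ≤ C * ‖h‖ * r * (2 * (C₁ * ‖h‖)) := by gcongr
      have b5' : C * ‖h‖ * ‖α (v + h) t - α v t‖ ≤ C * ‖h‖ * (2 * (C₁ * ‖h‖)) := by gcongr
      rw [e]
      refine (norm_add_le _ _).trans ?_
      refine (add_le_add_left (norm_add_le _ _) _).trans ?_
      refine (add_le_add_left (add_le_add_left (norm_add_le _ _) _) _).trans ?_
      refine (add_le_add_left (add_le_add_left (add_le_add_left (norm_add_le _ _) _) _) _).trans ?_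
      have hlast : D * ‖h‖ ^ 2 = C * ‖h‖ ^ 2 * r * N + C * ‖h‖ * ‖h‖ * N
        + C * ‖h‖ * r * (2 * (C₁ * ‖h‖)) + C * ‖h‖ * (2 * (C₁ * ‖h‖)) := by rw [hD]; ring
      linarith
  rw [hasFDerivAt_iff_isLittleO_nhds_zero]
  have hO : (fun h : E ↦ α (v + h) 1 - α v 1 - (A v).flip (α v 1) h)
      =O[𝓝 0] fun h : E ↦ ‖h‖ ^ 2 := by
    refine Asymptotics.IsBigO.of_bound (2 * D) ?_
    have h1 : ∀ᶠ h : E in 𝓝 0, v + h ∈ ball (0 : E) r := by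
      have : Filter.Tendsto (fun h : E ↦ v + h) (𝓝 0) (𝓝 v) := by
        have : Continuous (fun h : E ↦ v + h) := by fun_prop
        simpa using this.tendsto 0
      exact this (isOpen_ball.mem_nhds hv)
    filter_upwards [h1, ball_mem_nhds (0 : E) hr] with h hh hh'
    have := hquad h hh (mem_ball_zero_iff.mp hh').le
    simpa [mul_assoc] using this
  exact hO.trans_isLittleO (by simpa using Asymptotics.isLittleO_norm_pow_id one_lt_two)

/-- The first order Taylor formula with quadratic remainder, locally uniformly. -/
theorem exists_ball_taylor_bound {F : Type*} [NormedAddCommGroup F] [NormedSpace ℝ F]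
    {A : E → F} {x₀ : E} (hA : ContDiffAt ℝ 2 A x₀) :
    ∃ r > 0, ∃ C ≥ 0, (∀ x ∈ ball x₀ r, HasFDerivAt A (fderiv ℝ A x) x) ∧
      (∀ x ∈ ball x₀ r, ‖A x‖ ≤ C) ∧ (∀ x ∈ ball x₀ r, ‖fderiv ℝ A x‖ ≤ C) ∧
      ∀ x ∈ ball x₀ r, ∀ z ∈ ball x₀ r,
        ‖A z - A x - fderiv ℝ A x (z - x)‖ ≤ C * ‖z - x‖ ^ 2 := by
  have hD : ContDiffAt ℝ 1 (fderiv ℝ A) x₀ := hA.fderiv_right (by norm_num)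
  obtain ⟨K, s, hs, hK⟩ := hD.exists_lipschitzOnWith
  have e1 : ∀ᶠ x in 𝓝 x₀, DifferentiableAt ℝ A x :=
    (hA.eventually (by simp)).mono fun x hx ↦ hx.differentiableAt (by norm_num)
  have e2 : ∀ᶠ x in 𝓝 x₀, ‖A x‖ < ‖A x₀‖ + 1 :=
    hA.continuousAt.norm.eventually_lt continuousAt_const (by simp)
  have e3 : ∀ᶠ x in 𝓝 x₀, ‖fderiv ℝ A x‖ < ‖fderiv ℝ A x₀‖ + 1 :=
    hD.continuousAt.norm.eventually_lt continuousAt_const (by simp)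
  obtain ⟨r, hr, hball⟩ := Metric.eventually_nhds_iff_ball.mp
    (e1.and (e2.and (e3.and (Filter.eventually_mem_set.mpr hs))))
  refine ⟨r, hr, ‖A x₀‖ + 1 + (‖fderiv ℝ A x₀‖ + 1) + K, by positivity,
    fun x hx ↦ (hball x hx).1.hasFDerivAt, fun x hx ↦ ?_, fun x hx ↦ ?_, fun x hx z hz ↦ ?_⟩
  · have := (hball x hx).2.1.le
    have h1 : 0 ≤ ‖fderiv ℝ A x₀‖ := norm_nonneg _
    have h2 : 0 ≤ (K : ℝ) := K.2
    linarith
  · have := (hball x hx).2.2.1.le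
    have h1 : 0 ≤ ‖A x₀‖ := norm_nonneg _
    have h2 : 0 ≤ (K : ℝ) := K.2
    linarith
  · have hsub : segment ℝ x z ⊆ ball x₀ r := (convex_ball x₀ r).segment_subset hx hz
    have := (convex_segment x z).norm_image_sub_le_of_norm_hasFDerivWithin_le'
      (f := A) (f' := fderiv ℝ A) (φ := fderiv ℝ A x) (C := K * ‖z - x‖)
      (fun y hy ↦ (hball y (hsub hy)).1.hasFDerivAt.hasFDerivWithinAt) (fun y hy ↦ ?_)
      (left_mem_segment ℝ x z) (right_mem_segment ℝ x z)
    · refine this.trans ?_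
      have h1 : 0 ≤ ‖A x₀‖ + 1 + (‖fderiv ℝ A x₀‖ + 1) := by positivity
      nlinarith [sq_nonneg ‖z - x‖]
    · have h1 := hK.norm_sub_le (hball y (hsub hy)).2.2.2 (hball x hx).2.2.2
      refine h1.trans ?_
      gcongr
      exact norm_sub_le_of_mem_segment hy

/-- **Frobenius theorem** for flat linear systems: if `A` is a connection form of vanishing
curvature then through every initial value passes a solution of `dΦ = A Φ`. -/
theorem exists_parallel [CompleteSpace V] {A : E → E →L[ℝ] V →L[ℝ] V} {U : Set E} {x₀ : E}
    (hU : U ∈ 𝓝 x₀) (hA : ContDiffAt ℝ 2 A x₀)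
    (hflat : ∀ x ∈ U, ∀ (c d : E) (y : V),
      fderiv ℝ A x c d y + A x d (A x c y) = fderiv ℝ A x d c y + A x c (A x d y)) :
    ∃ r > 0, ball x₀ r ⊆ U ∧ ∀ y : V, ∃ Φ : E → V, Φ x₀ = y ∧
      ∀ x ∈ ball x₀ r, HasFDerivAt Φ ((A x).flip (Φ x)) x := by
  obtain ⟨r₁, hr₁, C, hC, h1, h2, h3, h4⟩ := exists_ball_taylor_bound hA
  obtain ⟨r₂, hr₂, hball⟩ := Metric.mem_nhds_iff.mp hU
  set r := min (min r₁ r₂) (2⁻¹ / (C + 1)) with hr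
  have hr0 : 0 < r := by positivity
  have hrr₁ : r ≤ r₁ := (min_le_left _ _).trans (min_le_left _ _)
  have hrr₂ : r ≤ r₂ := (min_le_left _ _).trans (min_le_right _ _)
  have hmem : ∀ v ∈ ball (0 : E) r, v + x₀ ∈ ball x₀ r := by
    intro v hv
    simpa [mem_ball, dist_eq_norm] using hv
  refine ⟨r, hr0, (ball_subset_ball hrr₂).trans hball, fun y ↦ ?_⟩
  obtain ⟨Φ, hΦ0, hΦ⟩ := exists_parallel_of_bounds (A := fun v ↦ A (v + x₀))
    (A' := fun v ↦ fderiv ℝ A (v + x₀)) hr0 hC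
    (fun v hv ↦ by
      simpa [Function.comp_def] using (h1 _ (ball_subset_ball hrr₁ (hmem v hv))).comp v
        ((hasFDerivAt_id v).add_const x₀))
    (fun v hv ↦ h2 _ (ball_subset_ball hrr₁ (hmem v hv)))
    (fun v hv ↦ h3 _ (ball_subset_ball hrr₁ (hmem v hv)))
    (fun v hv w hw ↦ by
      simpa using h4 _ (ball_subset_ball hrr₁ (hmem v hv)) _ (ball_subset_ball hrr₁ (hmem w hw)))
    (fun v hv ↦ hflat _ (hball (ball_subset_ball hrr₂ (hmem v hv))))
    (by
      have : C * r ≤ C * (2⁻¹ / (C + 1)) := by gcongr; exact min_le_right _ _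
      refine this.trans ?_
      rw [mul_div_assoc', div_le_iff₀ (by positivity)]
      linarith) y
  refine ⟨fun x ↦ Φ (x - x₀), by simpa using hΦ0, fun x hx ↦ ?_⟩
  have hx' : x - x₀ ∈ ball (0 : E) r := by simpa [mem_ball, dist_eq_norm] using hx
  simpa [Function.comp_def] using (hΦ _ hx').comp x ((hasFDerivAt_id x).sub_const x₀)

/-- Solutions of a linear system with smooth coefficients are smooth. -/
theorem contDiffOn_of_parallel {A : E → E →L[ℝ] V →L[ℝ] V} {U : Set E} (hU : IsOpen U)
    (hA : ContDiffOn ℝ ∞ A U) {Φ : E → V} (hΦ : ∀ x ∈ U, HasFDerivAt Φ ((A x).flip (Φ x)) x) :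
    ContDiffOn ℝ ∞ Φ U := by
  rw [contDiffOn_infty]
  intro k
  induction k with
  | zero => exact contDiffOn_zero.mpr fun x hx ↦ (hΦ x hx).continuousAt.continuousWithinAt
  | succ k ih =>
    push_cast
    rw [contDiffOn_succ_iff_fderiv_of_isOpen hU]
    refine ⟨fun x hx ↦ (hΦ x hx).differentiableAt.differentiableWithinAt, by simp, ?_⟩
    have h1 : ContDiffOn ℝ k (fun x ↦ (A x).flip (Φ x)) U := by
      have h2 : ContDiffOn ℝ k (fun x ↦ (A x).flip) U :=
        (ContinuousLinearMap.flipₗᵢ ℝ E V V).contDiff.comp_contDiffOn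
          (hA.of_le (by exact_mod_cast le_top))
      exact h2.clm_apply ih
    exact h1.congr fun x hx ↦ (hΦ x hx).fderiv

end Frobenius

section Orthonormal

variable {V : Type*} [AddCommGroup V] [Module ℝ V] [FiniteDimensional ℝ V] {n : ℕ}

theorem exists_orthonormal_family (G : V →ₗ[ℝ] V →ₗ[ℝ] ℝ) (hsymm : ∀ v w, G v w = G w v)
    (hpos : ∀ v, v ≠ 0 → 0 < G v v) (hn : Module.finrank ℝ V = n) :
    ∃ w : Fin n → V, ∀ i j, G (w i) (w j) = if i = j then 1 else 0 := by
  let core : InnerProductSpace.Core ℝ V :=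
    { inner v w := G v w
      conj_inner_symm v w := by simpa using hsymm w v
      re_inner_nonneg v := by
        rcases eq_or_ne v 0 with rfl | hv
        · simp
        · simpa using (hpos v hv).le
      add_left u v w := by simp
      smul_left u v r := by simp
      definite v hv := by
        by_contra h
        exact (hpos v h).ne' hv }
  let : NormedAddCommGroup V := core.toNormedAddCommGroup
  let : InnerProductSpace ℝ V := InnerProductSpace.ofCore core.toCore
  let e := (stdOrthonormalBasis ℝ V).reindex (finCongr hn)
  exact ⟨e, fun i j ↦ orthonormal_iff_ite.mp e.orthonormal i j⟩

theorem sum_orthonormal_family {G : V →ₗ[ℝ] V →ₗ[ℝ] ℝ} {w : Fin n → V}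
    (hw : ∀ i j, G (w i) (w j) = if i = j then 1 else 0) (hn : Module.finrank ℝ V = n) (c : V) :
    ∑ i, G (w i) c • w i = c := by
  have key (a : Fin n → ℝ) (j : Fin n) : G (w j) (∑ i, a i • w i) = a j := by
    simp [hw]
  have hli : LinearIndependent ℝ w := by
    rw [Fintype.linearIndependent_iff]
    intro a ha j
    rw [← key a j, ha, map_zero]
  have hspan := hli.span_eq_top_of_card_eq_finrank' (by simp [hn])
  obtain ⟨a, rfl⟩ := (Submodule.mem_span_range_iff_exists_fun ℝ).mp
    (hspan ▸ Submodule.mem_top : c ∈ Submodule.span ℝ (Set.range w))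
  simp [key]

end Orthonormal

section Tractor

open Set Metric

variable {E : Type*} [NormedAddCommGroup E] [NormedSpace ℝ E]

/-- Coordinate expressions `(G, Γ, b)` of a Riemannian metric, its Christoffel symbols and a
self-adjoint endomorphism solving the Gauss-Codazzi equations at infinity. -/
structure IsLocalSolution (U : Set E) (G : E → E →L[ℝ] E →L[ℝ] ℝ) (Γ : E → E →L[ℝ] E →L[ℝ] E)
    (b : E → E →L[ℝ] E) : Prop where
  contDiffOn_metric : ContDiffOn ℝ ∞ G U
  contDiffOn_christoffel : ContDiffOn ℝ ∞ Γ U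
  contDiffOn_endo : ContDiffOn ℝ ∞ b U
  symm : ∀ x ∈ U, ∀ c d, G x c d = G x d c
  pos : ∀ x ∈ U, ∀ c, c ≠ 0 → 0 < G x c c
  compat : ∀ x ∈ U, ∀ c d e,
    fderiv ℝ G x c d e = G x (Γ x c d) e + G x d (Γ x c e)
  torsion_free : ∀ x ∈ U, ∀ c d, Γ x c d = Γ x d c
  self_adjoint : ∀ x ∈ U, ∀ c d, G x (b x c) d = G x c (b x d)
  codazzi : ∀ x ∈ U, ∀ c d,
    fderiv ℝ b x c d + Γ x c (b x d) = fderiv ℝ b x d c + Γ x d (b x c)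
  gauss : ∀ x ∈ U, ∀ c d e,
    fderiv ℝ Γ x c d e - fderiv ℝ Γ x d c e + Γ x c (Γ x d e) - Γ x d (Γ x c e) =
      -(1 / 2 : ℝ) • (G x (b x d) e • c + G x d e • b x c - G x c e • b x d - G x (b x c) e • d)

variable [FiniteDimensional ℝ E]

/-- The connection form of the conformal tractor connection, with `-II / 2` in the place of the
Schouten tensor: `(f, W, ν)` is parallel if and only if `W` is the gradient of `f`,
`∇_c W = -ν c + (f / 2) b c` and `dν(c) = -II(c, W) / 2`. -/
def tractorForm (G : E → E →L[ℝ] E →L[ℝ] ℝ) (Γ : E → E →L[ℝ] E →L[ℝ] E) (b : E → E →L[ℝ] E)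
    (x : E) : E →L[ℝ] (ℝ × E × ℝ) →L[ℝ] (ℝ × E × ℝ) :=
  (LinearMap.mk₂ ℝ (fun (c : E) (y : ℝ × E × ℝ) ↦
      ((G x y.2.1 c, -Γ x c y.2.1 - y.2.2 • c + (1 / 2 * y.1) • b x c,
        -(1 / 2) * G x (b x c) y.2.1) : ℝ × E × ℝ))
    (fun c d y ↦ by
      ext <;> simp
      · module
      · ring)
    (fun r c y ↦ by
      ext <;> simp
      · module
      · ring)
    (fun c y z ↦ by
      ext <;> simp
      · module
      · ring)
    (fun r c y ↦ by
      ext <;> simp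
      · module
      · ring)).toContinuousBilinearMap

theorem tractorForm_apply (G : E → E →L[ℝ] E →L[ℝ] ℝ) (Γ : E → E →L[ℝ] E →L[ℝ] E)
    (b : E → E →L[ℝ] E) (x c : E) (y : ℝ × E × ℝ) :
    tractorForm G Γ b x c y =
      (G x y.2.1 c, -Γ x c y.2.1 - y.2.2 • c + (1 / 2 * y.1) • b x c,
        -(1 / 2) * G x (b x c) y.2.1) := rfl

namespace IsLocalSolution

variable {U : Set E} {G : E → E →L[ℝ] E →L[ℝ] ℝ} {Γ : E → E →L[ℝ] E →L[ℝ] E}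
  {b : E → E →L[ℝ] E}

theorem contDiffOn_tractorForm (h : IsLocalSolution U G Γ b) :
    ContDiffOn ℝ ∞ (tractorForm G Γ b) U := by
  rw [contDiffOn_clm_apply]
  intro c
  rw [contDiffOn_clm_apply]
  intro y
  simp only [tractorForm_apply]
  have hG := h.contDiffOn_metric
  have hΓ := h.contDiffOn_christoffel
  have hb := h.contDiffOn_endo
  refine ContDiffOn.prodMk ?_ (ContDiffOn.prodMk ?_ ?_)
  · fun_prop
  · fun_prop
  · exact contDiffOn_const.mul ((hG.clm_apply (hb.clm_apply contDiffOn_const)).clm_apply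
      contDiffOn_const)

theorem fderiv_tractorForm (h : IsLocalSolution U G Γ b) (hU : IsOpen U) {x : E} (hx : x ∈ U)
    (c d : E) (y : ℝ × E × ℝ) :
    fderiv ℝ (tractorForm G Γ b) x c d y =
      (fderiv ℝ G x c y.2.1 d, -fderiv ℝ Γ x c d y.2.1 + (1 / 2 * y.1) • fderiv ℝ b x c d,
        -(1 / 2) * (fderiv ℝ G x c (b x d) y.2.1 + G x (fderiv ℝ b x c d) y.2.1)) := by
  have hUx := hU.mem_nhds hx
  have hd {F : Type _} [NormedAddCommGroup F] [NormedSpace ℝ F] {f : E → F}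
      (hf : ContDiffOn ℝ ∞ f U) : HasFDerivAt f (fderiv ℝ f x) x :=
    ((hf.contDiffAt hUx).differentiableAt (by simp)).hasFDerivAt
  have hA := ((hd h.contDiffOn_tractorForm).clm_apply (hasFDerivAt_const d x)).clm_apply
    (hasFDerivAt_const y x)
  have hG := hd h.contDiffOn_metric
  have hΓ := hd h.contDiffOn_christoffel
  have hb := hd h.contDiffOn_endo
  have h1 := (hG.clm_apply (hasFDerivAt_const y.2.1 x)).clm_apply (hasFDerivAt_const d x)
  have h2 := (((hΓ.clm_apply (hasFDerivAt_const d x)).clm_apply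
    (hasFDerivAt_const y.2.1 x)).neg.sub_const (y.2.2 • d)).add
      ((hb.clm_apply (hasFDerivAt_const d x)).const_smul (1 / 2 * y.1))
  have h3 := ((hG.clm_apply (hb.clm_apply (hasFDerivAt_const d x))).clm_apply
    (hasFDerivAt_const y.2.1 x)).const_mul (-(1 / 2))
  have := congrArg (fun L ↦ L c) (hA.unique (h1.prodMk (h2.prodMk h3)))
  simp only [ContinuousLinearMap.prod_apply, add_apply, ContinuousLinearMap.comp_apply,
    ContinuousLinearMap.flip_apply, smul_apply, neg_apply, zero_apply, map_zero, zero_add,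
    smul_eq_mul] at this
  rw [this]
  ext <;> simp
  ring

theorem tractorForm_flat (h : IsLocalSolution U G Γ b) (hU : IsOpen U) {x : E} (hx : x ∈ U)
    (c d : E) (y : ℝ × E × ℝ) :
    fderiv ℝ (tractorForm G Γ b) x c d y
        + tractorForm G Γ b x d (tractorForm G Γ b x c y) =
      fderiv ℝ (tractorForm G Γ b) x d c y
        + tractorForm G Γ b x c (tractorForm G Γ b x d y) := by
  obtain ⟨f, W, ν⟩ := y
  rw [h.fderiv_tractorForm hU hx, h.fderiv_tractorForm hU hx]
  simp only [tractorForm_apply, Prod.mk_add_mk]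
  have hs := h.symm x hx
  have hcomp := h.compat x hx
  have htor := h.torsion_free x hx
  have hsa := h.self_adjoint x hx
  have hcod := h.codazzi x hx c d
  have hgauss := h.gauss x hx c d W
  refine Prod.ext ?_ (Prod.ext ?_ ?_)
  · simp only [hcomp, map_add, map_sub, map_neg, map_smul, add_apply, sub_apply, neg_apply,
      smul_apply, smul_eq_mul, htor d c, hs d c, hsa d c, hs d (b x c)]
    ring
  · simp only [map_add, map_sub, map_neg, map_smul, neg_smul, mul_smul]
    have hcod' : fderiv ℝ b x c d = fderiv ℝ b x d c + Γ x d (b x c) - Γ x c (b x d) :=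
      eq_sub_of_add_eq hcod
    have hgauss' : fderiv ℝ Γ x c d W = fderiv ℝ Γ x d c W - Γ x c (Γ x d W) + Γ x d (Γ x c W)
      -(1 / 2 : ℝ) • (G x (b x d) W • c + G x d W • b x c - G x c W • b x d
        - G x (b x c) W • d) := by
      rw [← sub_eq_zero] at hgauss ⊢
      rw [← hgauss]
      module
    rw [hcod', hgauss', htor d c, hs W c, hs W d]
    module
  · have e1 := congrArg (fun v ↦ G x v W) hcod
    simp only [map_add, add_apply] at e1
    simp only [hcomp, map_add, map_sub, map_neg, map_smul, smul_eq_mul]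
    have e2 : G x (b x d) c = G x (b x c) d := by rw [hsa, hs]
    rw [e2, hs (b x d) (b x c)]
    linear_combination (-(1 / 2 : ℝ)) * e1

end IsLocalSolution

end Tractor

section ConformalMap

open Set Metric

namespace IsLocalSolution

variable {E : Type*} [NormedAddCommGroup E] [NormedSpace ℝ E] [FiniteDimensional ℝ E]
  {U : Set E} {G : E → E →L[ℝ] E →L[ℝ] ℝ} {Γ : E → E →L[ℝ] E →L[ℝ] E} {b : E → E →L[ℝ] E}

/-- The tractor metric is constant on pairs of parallel tractors. -/
theorem pairing_eq (h : IsLocalSolution U G Γ b) (hU : IsOpen U) {x₀ : E} {r : ℝ}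
    (hr : ball x₀ r ⊆ U) {Φ Ψ : E → ℝ × E × ℝ}
    (hΦ : ∀ x ∈ ball x₀ r, HasFDerivAt Φ ((tractorForm G Γ b x).flip (Φ x)) x)
    (hΨ : ∀ x ∈ ball x₀ r, HasFDerivAt Ψ ((tractorForm G Γ b x).flip (Ψ x)) x)
    {x : E} (hx : x ∈ ball x₀ r) :
    G x (Φ x).2.1 (Ψ x).2.1 + (Φ x).1 * (Ψ x).2.2 + (Φ x).2.2 * (Ψ x).1 =
      G x₀ (Φ x₀).2.1 (Ψ x₀).2.1 + (Φ x₀).1 * (Ψ x₀).2.2 + (Φ x₀).2.2 * (Ψ x₀).1 := by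
  have hx₀ : x₀ ∈ ball x₀ r := mem_ball_self (dist_nonneg.trans_lt hx)
  have key : ∀ z ∈ ball x₀ r, HasFDerivAt (fun z ↦ G z (Φ z).2.1 (Ψ z).2.1
      + (Φ z).1 * (Ψ z).2.2 + (Φ z).2.2 * (Ψ z).1) (0 : E →L[ℝ] ℝ) z := by
    intro z hz
    have hG : HasFDerivAt G (fderiv ℝ G z) z :=
      ((h.contDiffOn_metric.contDiffAt (hU.mem_nhds (hr hz))).differentiableAt
        (by simp)).hasFDerivAt
    have h1 := (hG.clm_apply (hΦ z hz).snd.fst).clm_apply (hΨ z hz).snd.fst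
    have h2 := (hΦ z hz).fst.mul (hΨ z hz).snd.snd
    have h3 := (hΦ z hz).snd.snd.mul (hΨ z hz).fst
    refine ((h1.add h2).add h3).congr_fderiv ?_
    ext c
    have hs := h.symm z (hr hz)
    have hcomp := h.compat z (hr hz)
    have hsa := h.self_adjoint z (hr hz)
    simp only [add_apply, ContinuousLinearMap.comp_apply, ContinuousLinearMap.flip_apply,
      ContinuousLinearMap.coe_fst', ContinuousLinearMap.coe_snd', smul_apply, smul_eq_mul,
      tractorForm_apply, zero_apply, map_add, map_sub, map_neg, map_smul, sub_apply, neg_apply,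
      hcomp]
    rw [hs (Φ z).2.1 (b z c), hs (Φ z).2.1 c, hs (Ψ z).2.1 c]
    ring
  exact (convex_ball x₀ r).is_const_of_fderivWithin_eq_zero (𝕜 := ℝ)
    (fun z hz ↦ (key z hz).differentiableAt.differentiableWithinAt)
    (fun z hz ↦ (key z hz).hasFDerivWithinAt.fderivWithin
      (isOpen_ball.uniqueDiffWithinAt hz)) hx hx₀

end IsLocalSolution

/-- The model space of an `n`-manifold. -/
abbrev Eucl (n : ℕ) := EuclideanSpace ℝ (Fin n)

/-- Around each point, a local solution is conformal to the Euclidean metric. -/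
theorem IsLocalSolution.exists_conformal_map {n : ℕ} {U : Set (Eucl n)}
    {G : Eucl n → Eucl n →L[ℝ] Eucl n →L[ℝ] ℝ}
    {Γ : Eucl n →
      Eucl n →L[ℝ] Eucl n →L[ℝ] Eucl n}
    {b : Eucl n → Eucl n →L[ℝ] Eucl n}
    (h : IsLocalSolution U G Γ b) (hU : IsOpen U) {x₀ : Eucl n} (hx₀ : x₀ ∈ U) :
    ∃ V ⊆ U, IsOpen V ∧ x₀ ∈ V ∧ ∃ (s : Eucl n → ℝ)
      (φ : Eucl n → Eucl n),
      ContDiffOn ℝ ∞ s V ∧ ContDiffOn ℝ ∞ φ V ∧ (∀ x ∈ V, 0 < s x) ∧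
      ∀ x ∈ V, ∀ c d, G x c d = s x ^ 2 * inner ℝ (fderiv ℝ φ x c) (fderiv ℝ φ x d) := by
  have hrank : Module.finrank ℝ (Eucl n) = n := by simp
  obtain ⟨w, hw⟩ := exists_orthonormal_family (n := n)
    (ContinuousLinearMap.toLinearMap₁₂ (G x₀)) (h.symm x₀ hx₀) (h.pos x₀ hx₀) hrank
  have hw' : ∀ i j, G x₀ (w i) (w j) = if i = j then 1 else 0 := hw
  have hA := h.contDiffOn_tractorForm
  obtain ⟨r, hr, hrU, hex⟩ := exists_parallel (hU.mem_nhds hx₀)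
    ((hA.contDiffAt (hU.mem_nhds hx₀)).of_le (by norm_cast))
    (fun x hx ↦ h.tractorForm_flat hU hx)
  obtain ⟨Φ, hΦ0, hΦ⟩ := hex (1, 0, 0)
  choose Ψ hΨ0 hΨ using fun i ↦ hex (0, w i, 0)
  have hΦs := contDiffOn_of_parallel isOpen_ball (hA.mono hrU) hΦ
  have hΨs := fun i ↦ contDiffOn_of_parallel isOpen_ball (hA.mono hrU) (hΨ i)
  have hs : ContDiffOn ℝ ∞ (fun x ↦ (Φ x).1) (ball x₀ r) := hΦs.fst
  set V := ball x₀ r ∩ (fun x ↦ (Φ x).1) ⁻¹' Ioi 0 with hV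
  have hVo : IsOpen V := hs.continuousOn.isOpen_inter_preimage isOpen_ball isOpen_Ioi
  have hVb : V ⊆ ball x₀ r := inter_subset_left
  have hφi : ∀ i, ContDiffOn ℝ ∞ (fun x ↦ (Ψ i x).1 / (Φ x).1) V := fun i ↦
    ((hΨs i).fst.mono hVb).div (hs.mono hVb) fun x hx ↦ (show 0 < (Φ x).1 from hx.2).ne'
  refine ⟨V, hVb.trans hrU, hVo, ⟨mem_ball_self hr, by simp [hΦ0]⟩, fun x ↦ (Φ x).1,
    fun x ↦ WithLp.toLp 2 fun i ↦ (Ψ i x).1 / (Φ x).1, hs.mono hVb, ?_, fun x hx ↦ hx.2, ?_⟩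
  · rw [contDiffOn_euclidean]
    exact hφi
  intro x hx c d
  have hxb := hVb hx
  have hf : 0 < (Φ x).1 := hx.2
  have hG := h.symm x (hrU hxb)
  have p00 := h.pairing_eq hU hrU hΦ hΦ hxb
  have p0i := fun i ↦ h.pairing_eq hU hrU hΦ (hΨ i) hxb
  have pij := fun i j ↦ h.pairing_eq hU hrU (hΨ i) (hΨ j) hxb
  simp only [hΦ0, hΨ0, hw', map_zero, zero_apply, mul_zero, zero_mul, add_zero] at p00 p0i pij
  set f := (Φ x).1 with hfdef
  set W₀ := (Φ x).2.1
  set ν₀ := (Φ x).2.2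
  have hortho : ∀ i j, G x (f⁻¹ • (f • (Ψ i x).2.1 - (Ψ i x).1 • W₀))
      (f⁻¹ • (f • (Ψ j x).2.1 - (Ψ j x).1 • W₀)) = if i = j then 1 else 0 := by
    intro i j
    rw [← pij i j]
    simp only [map_sub, map_smul, smul_apply, sub_apply, smul_eq_mul]
    rw [hG (Ψ i x).2.1 W₀]
    have a1 : G x W₀ (Ψ i x).2.1 = -(f * (Ψ i x).2.2 + ν₀ * (Ψ i x).1) := by
      linear_combination p0i i
    have a2 : G x W₀ (Ψ j x).2.1 = -(f * (Ψ j x).2.2 + ν₀ * (Ψ j x).1) := by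
      linear_combination p0i j
    have a3 : G x W₀ W₀ = -(f * ν₀ + ν₀ * f) := by linear_combination p00
    rw [a1, a2, a3]
    field_simp
    ring
  have hder : ∀ i c, fderiv ℝ (fun x ↦ (WithLp.toLp 2 fun i ↦ (Ψ i x).1 / (Φ x).1 : Eucl n)) x c i =
      f⁻¹ * G x (f⁻¹ • (f • (Ψ i x).2.1 - (Ψ i x).1 • W₀)) c := by
    intro i c
    have hd : HasFDerivAt (fun x ↦ (Ψ i x).1 * (Φ x).1⁻¹) _ x :=
      (hΨ i x hxb).fst.mul ((hasDerivAt_inv hf.ne').comp_hasFDerivAt x (hΦ x hxb).fst)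
    simp only [← div_eq_mul_inv] at hd
    have hdiff : DifferentiableAt ℝ (fun x ↦ (WithLp.toLp 2 fun i ↦ (Ψ i x).1 / (Φ x).1 : Eucl n)) x :=
      ((contDiffOn_euclidean.mpr hφi).contDiffAt (hVo.mem_nhds hx)).differentiableAt (by simp)
    have hd2 := (EuclideanSpace.proj (𝕜 := ℝ) i).hasFDerivAt.comp x hdiff.hasFDerivAt
    have := congrArg (fun L ↦ L c) (hd2.unique hd)
    simp only [ContinuousLinearMap.comp_apply] at this
    refine Eq.trans this ?_
    simp only [add_apply, smul_apply, ContinuousLinearMap.comp_apply,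
      ContinuousLinearMap.flip_apply, tractorForm_apply, ContinuousLinearMap.coe_fst', ← hfdef,
      map_smul, map_sub, sub_apply, smul_eq_mul]
    field_simp
    ring
  have hsum := sum_orthonormal_family (G := ContinuousLinearMap.toLinearMap₁₂ (G x)) hortho hrank c
  have hsum' := congrArg (fun v ↦ G x v d) hsum
  simp only [map_sum, sum_apply] at hsum'
  rw [← hsum', PiLp.inner_apply, Finset.mul_sum]
  refine Finset.sum_congr rfl fun i _ ↦ ?_
  rw [hder, hder]
  simp only [← hfdef]
  simp
  field_simp

end ConformalMap

section Christoffel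

variable {E : Type*} [NormedAddCommGroup E] [NormedSpace ℝ E] [FiniteDimensional ℝ E]

theorem isInvertible_of_pos {G : E →L[ℝ] E →L[ℝ] ℝ} (hpos : ∀ c, c ≠ 0 → 0 < G c c) :
    G.IsInvertible := by
  have hinj : Function.Injective G.toLinearMap := by
    rw [injective_iff_map_eq_zero]
    intro v hv
    by_contra h
    have h1 := hpos v h
    have h2 : G v = 0 := hv
    simp [h2] at h1
  have hdim : Module.finrank ℝ E = Module.finrank ℝ (E →L[ℝ] ℝ) := by
    rw [← (LinearMap.toContinuousLinearMap (𝕜 := ℝ) (E := E) (F' := ℝ)).finrank_eq]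
    exact (Subspace.dual_finrank_eq).symm
  exact ⟨(LinearMap.linearEquivOfInjective _ hinj hdim).toContinuousLinearEquiv, by ext; rfl⟩

/-- The Christoffel symbols of the first kind of the metric `G`, as covectors. -/
def christoffelFst (G : E → E →L[ℝ] E →L[ℝ] ℝ) (y c d : E) : E →L[ℝ] ℝ :=
  (1 / 2 : ℝ) • (fderiv ℝ G y c d + fderiv ℝ G y d c - ((fderiv ℝ G y).flip c).flip d)

/-- The Christoffel symbols of the metric `G`. -/
def christoffel (G : E → E →L[ℝ] E →L[ℝ] ℝ) (y : E) : E →L[ℝ] E →L[ℝ] E :=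
  (LinearMap.mk₂ ℝ (fun c d ↦ (G y).inverse (christoffelFst G y c d))
    (fun c d e ↦ by
      rw [← map_add]; congr 1; ext; simp [christoffelFst]; ring)
    (fun r c d ↦ by
      rw [← map_smul]; congr 1; ext; simp [christoffelFst]; ring)
    (fun c d e ↦ by
      rw [← map_add]; congr 1; ext; simp [christoffelFst]; ring)
    (fun r c d ↦ by
      rw [← map_smul]; congr 1; ext; simp [christoffelFst]; ring)).toContinuousBilinearMap

theorem christoffel_apply (G : E → E →L[ℝ] E →L[ℝ] ℝ) (y c d : E) :
    christoffel G y c d = (G y).inverse (christoffelFst G y c d) := rfl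

theorem metric_christoffel {G : E → E →L[ℝ] E →L[ℝ] ℝ} {y : E}
    (hpos : ∀ c, c ≠ 0 → 0 < G y c c) (c d e : E) :
    G y (christoffel G y c d) e =
      1 / 2 * (fderiv ℝ G y c d e + fderiv ℝ G y d c e - fderiv ℝ G y e c d) := by
  rw [christoffel_apply, (isInvertible_of_pos hpos).self_apply_inverse]
  simp [christoffelFst]

omit [FiniteDimensional ℝ E] in
theorem fderiv_metric_symm {G : E → E →L[ℝ] E →L[ℝ] ℝ} {y : E} (hG : DifferentiableAt ℝ G y)
    (hsymm : ∀ᶠ z in 𝓝 y, ∀ c d, G z c d = G z d c) (c d e : E) :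
    fderiv ℝ G y c d e = fderiv ℝ G y c e d := by
  have h1 := (hG.hasFDerivAt.clm_apply (hasFDerivAt_const d y)).clm_apply (hasFDerivAt_const e y)
  have h2 := (hG.hasFDerivAt.clm_apply (hasFDerivAt_const e y)).clm_apply (hasFDerivAt_const d y)
  have h3 := h1.congr_of_eventuallyEq (hsymm.mono fun z hz ↦ hz e d)
  have := congrArg (fun L ↦ L c) (h3.unique h2)
  simpa using this

theorem christoffel_compat {G : E → E →L[ℝ] E →L[ℝ] ℝ} {y : E} (hG : DifferentiableAt ℝ G y)
    (hsymm : ∀ᶠ z in 𝓝 y, ∀ c d, G z c d = G z d c)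
    (hpos : ∀ c, c ≠ 0 → 0 < G y c c) (c d e : E) :
    fderiv ℝ G y c d e = G y (christoffel G y c d) e + G y d (christoffel G y c e) := by
  rw [hsymm.self_of_nhds d, metric_christoffel hpos, metric_christoffel hpos]
  have hs := fderiv_metric_symm hG hsymm
  rw [hs c e d, hs d c e, hs e c d]
  ring

theorem christoffel_symm {G : E → E →L[ℝ] E →L[ℝ] ℝ} {y : E} (hG : DifferentiableAt ℝ G y)
    (hsymm : ∀ᶠ z in 𝓝 y, ∀ c d, G z c d = G z d c) (c d : E) :
    christoffel G y c d = christoffel G y d c := by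
  rw [christoffel_apply, christoffel_apply]
  congr 1
  ext e
  simp [christoffelFst, fderiv_metric_symm hG hsymm e c d]
  ring

theorem contDiffOn_christoffel {G : E → E →L[ℝ] E →L[ℝ] ℝ} {U : Set E} (hU : IsOpen U)
    (hG : ContDiffOn ℝ ∞ G U) (hpos : ∀ y ∈ U, ∀ c, c ≠ 0 → 0 < G y c c) :
    ContDiffOn ℝ ∞ (christoffel G) U := by
  rw [contDiffOn_clm_apply]
  intro c
  rw [contDiffOn_clm_apply]
  intro d
  simp only [christoffel_apply]
  refine ContDiffOn.clm_apply (fun y hy ↦ ?_) ?_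
  · obtain ⟨e, he⟩ := isInvertible_of_pos (hpos y hy)
    have := contDiffAt_map_inverse (n := ∞) e
    rw [he] at this
    exact this.comp_contDiffWithinAt y (hG y hy)
  · rw [contDiffOn_clm_apply]
    intro e
    simp only [christoffelFst, smul_apply, sub_apply, add_apply, ContinuousLinearMap.flip_apply]
    have hD : ContDiffOn ℝ ∞ (fderiv ℝ G) U := hG.fderiv_of_isOpen hU (by simp)
    have hD' (u v w : E) : ContDiffOn ℝ ∞ (fun y ↦ fderiv ℝ G y u v w) U :=
      ((hD.clm_apply contDiffOn_const).clm_apply contDiffOn_const).clm_apply contDiffOn_const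
    exact (((hD' _ _ _).add (hD' _ _ _)).sub (hD' _ _ _)).const_smul _

end Christoffel

section Coordinates

variable {n : ℕ} {M : Type*} [TopologicalSpace M] [ChartedSpace (EuclideanSpace ℝ (Fin n)) M]

/-- The differential at `x` of the preferred chart at `p`. -/
def toCoord (p x : M) : TangentSpace (𝓡 n) x →L[ℝ] Eucl n :=
  mfderiv (𝓡 n) 𝓘(ℝ, Eucl n) (extChartAt (𝓡 n) p) x

/-- The inverse of the differential at `x` of the preferred chart at `p`. -/
def ofCoord (p x : M) : Eucl n →L[ℝ] TangentSpace (𝓡 n) x :=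
  (toCoord p x).inverse

/-- The vector field on `M` with coordinate expression `W` in the preferred chart at `p`. -/
def lift (p : M) (W : Eucl n → Eucl n) : VField n M :=
  fun x ↦ ofCoord p x (W (extChartAt (𝓡 n) p x))

variable [IsManifold (𝓡 n) ∞ M] {p x : M}

theorem isInvertible_toCoord (hx : x ∈ (chartAt (Eucl n) p).source) :
    (toCoord p x : TangentSpace (𝓡 n) x →L[ℝ] Eucl n).IsInvertible :=
  have : IsManifold (𝓡 n) 1 M := .of_le (n := ∞) (by norm_cast)
  isInvertible_mfderiv_extChartAt (by simpa using hx)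

theorem toCoord_ofCoord (hx : x ∈ (chartAt (Eucl n) p).source) (c : Eucl n) :
    toCoord p x (ofCoord p x c) = c :=
  (isInvertible_toCoord hx).self_apply_inverse c

theorem ofCoord_toCoord (hx : x ∈ (chartAt (Eucl n) p).source) (v : TangentSpace (𝓡 n) x) :
    ofCoord p x (toCoord p x v) = v :=
  (isInvertible_toCoord hx).inverse_apply_self v

theorem smoothAt_lift (hx : x ∈ (chartAt (Eucl n) p).source) {W : Eucl n → Eucl n}
    (hW : ContDiffAt ℝ ∞ W (extChartAt (𝓡 n) p x)) : SmoothAt (lift p W : VField n M) x := by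
  have : IsManifold (𝓡 n) 1 M := .of_le (n := ∞) (by norm_cast)
  exact ContMDiffAt.mpullback_vectorField_preimage (n := ∞) (m := ∞)
    (contMDiffAt_vectorSpace_iff_contDiffAt.mpr hW) (contMDiffAt_extChartAt' hx)
    (isInvertible_toCoord hx) (by simp)

theorem SmoothAt.diffAt {X : VField n M} (hX : SmoothAt X x) : DiffAt X x :=
  ContMDiffAt.mdifferentiableAt hX (by simp)

theorem mlieBracket_lift (hx : x ∈ (chartAt (Eucl n) p).source) {V W : Eucl n → Eucl n}
    (hV : ContDiffAt ℝ ∞ V (extChartAt (𝓡 n) p x)) (hW : ContDiffAt ℝ ∞ W (extChartAt (𝓡 n) p x)) :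
    mlieBracket (𝓡 n) (lift p V : VField n M) (lift p W) x =
      lift p (fun y ↦ fderiv ℝ W y (V y) - fderiv ℝ V y (W y)) x := by
  have : IsManifold (𝓡 n) (minSmoothness ℝ 2) M := .of_le (n := ∞) (by simp; norm_cast)
  have h1 := mpullback_mlieBracket (I := 𝓡 n) (I' := 𝓘(ℝ, Eucl n)) (n := ∞)
    (f := extChartAt (𝓡 n) p)
    ((contMDiffAt_vectorSpace_iff_contDiffAt.mpr hV).mdifferentiableAt (by simp))
    ((contMDiffAt_vectorSpace_iff_contDiffAt.mpr hW).mdifferentiableAt (by simp))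
    (contMDiffAt_extChartAt' hx) (by simp; norm_cast)
  refine h1.symm.trans ?_
  have h2 : mlieBracket 𝓘(ℝ, Eucl n) V W = fun y ↦ fderiv ℝ W y (V y) - fderiv ℝ V y (W y) :=
    mlieBracketWithin_univ.symm.trans (mlieBracketWithin_eq_lieBracketWithin.trans
      (lieBracketWithin_univ.trans lieBracket_eq))
  exact congrArg (fun X ↦ mpullback (𝓡 n) 𝓘(ℝ, Eucl n) (extChartAt (𝓡 n) p) X x) h2

theorem mvfderiv_lift (hx : x ∈ (chartAt (Eucl n) p).source) {f : M → ℝ} {h : Eucl n → ℝ}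
    (hfh : ∀ z ∈ (chartAt (Eucl n) p).source, f z = h (extChartAt (𝓡 n) p z))
    (hh : DifferentiableAt ℝ h (extChartAt (𝓡 n) p x)) (V : Eucl n → Eucl n) :
    mvfderiv (𝓡 n) f x (lift p V x) =
      fderiv ℝ h (extChartAt (𝓡 n) p x) (V (extChartAt (𝓡 n) p x)) := by
  have h1 : f =ᶠ[𝓝 x] h ∘ extChartAt (𝓡 n) p := by
    filter_upwards [(chartAt (Eucl n) p).open_source.mem_nhds hx] with z hz using hfh z hz
  have h2 : mvfderiv (𝓡 n) f x (lift p V x) =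
      mvfderiv (𝓡 n) (h ∘ extChartAt (𝓡 n) p) x (lift p V x) := by
    have : mfderiv (𝓡 n) 𝓘(ℝ, ℝ) f x = mfderiv (𝓡 n) 𝓘(ℝ, ℝ) (h ∘ extChartAt (𝓡 n) p) x :=
      h1.mfderiv_eq
    exact congrArg (fun L ↦ L (lift p V x)) this
  rw [h2, mvfderiv_comp_apply x hh.mdifferentiableAt
    ((contMDiffAt_extChartAt' (I := 𝓡 n) (n := ∞) hx).mdifferentiableAt (by simp))]
  have h3 : mfderiv (𝓡 n) 𝓘(ℝ, Eucl n) (extChartAt (𝓡 n) p) x (lift p V x) =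
    V (extChartAt (𝓡 n) p x) := toCoord_ofCoord hx _
  have h4 : mvfderiv 𝓘(ℝ, Eucl n) h (extChartAt (𝓡 n) p x) =
      fderiv ℝ h (extChartAt (𝓡 n) p x) := mfderiv_eq_fderiv
  rw [h4]
  exact congrArg _ h3

/-- A smooth vector field has smooth coordinates. -/
theorem SmoothAt.contDiffAt_toCoord {X : VField n M} (hx : x ∈ (chartAt (Eucl n) p).source)
    (hX : SmoothAt X x) : ContMDiffAt (𝓡 n) 𝓘(ℝ, Eucl n) ∞ (fun z ↦ toCoord p z (X z)) x := by
  have : IsManifold (𝓡 n) 1 M := .of_le (n := ∞) (by norm_cast)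
  have h1 := (Bundle.Trivialization.contMDiffAt_section_iff
    (trivializationAt (Eucl n) (TangentSpace (𝓡 n)) p) (by simpa using hx)).mp hX
  refine h1.congr_of_eventuallyEq ?_
  filter_upwards [(chartAt (Eucl n) p).open_source.mem_nhds hx] with z hz
  have h2 := congrArg (fun L : TangentSpace (𝓡 n) z →L[ℝ] Eucl n ↦ L (X z))
    (TangentBundle.continuousLinearMapAt_trivializationAt (I := 𝓡 n) hz)
  refine (h2.symm.trans ?_)
  exact Bundle.Trivialization.coe_linearMapAt_of_mem _ (by simpa using hz) |> fun h ↦ congrFun h _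

theorem contDiffOn_comp_extChartAt_symm {F : Type*} [NormedAddCommGroup F] [NormedSpace ℝ F]
    {f : M → F} (hf : ∀ x ∈ (chartAt (Eucl n) p).source, ContMDiffAt (𝓡 n) 𝓘(ℝ, F) ∞ f x) :
    ContDiffOn ℝ ∞ (fun y ↦ f ((extChartAt (𝓡 n) p).symm y)) (extChartAt (𝓡 n) p).target := by
  rw [← contMDiffOn_iff_contDiffOn]
  intro y hy
  have hy' : (extChartAt (𝓡 n) p).symm y ∈ (chartAt (Eucl n) p).source := by
    simpa using (extChartAt (𝓡 n) p).map_target hy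
  exact (hf _ hy').comp_contMDiffWithinAt y (contMDiffOn_extChartAt_symm p y hy)

end Coordinates

section CoordinateTensors

variable {n : ℕ} {M : Type*} [TopologicalSpace M] [ChartedSpace (EuclideanSpace ℝ (Fin n)) M]
  [IsManifold (𝓡 n) ∞ M]

/-- The coordinate expression of the metric `g` in the preferred chart at `p`. -/
def coordMetric (g : RMetric n M) (p : M) (y : Eucl n) : Eucl n →L[ℝ] Eucl n →L[ℝ] ℝ :=
  (LinearMap.mk₂ ℝ (fun c d ↦ g.inner ((extChartAt (𝓡 n) p).symm y)
      (ofCoord p _ c) (ofCoord p _ d))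
    (fun c d e ↦ by simp only [map_add, add_apply])
    (fun r c d ↦ by simp only [map_smul, smul_apply])
    (fun c d e ↦ by simp only [map_add])
    (fun r c d ↦ by simp only [map_smul])).toContinuousBilinearMap

/-- The coordinate expression of the endomorphism field `B` in the preferred chart at `p`. -/
def coordEndo (B : EndField n M) (p : M) (y : Eucl n) : Eucl n →L[ℝ] Eucl n :=
  (toCoord p ((extChartAt (𝓡 n) p).symm y)).comp
    ((B ((extChartAt (𝓡 n) p).symm y)).comp (ofCoord p _))

variable {p x : M}

theorem coordMetric_apply (g : RMetric n M) (hx : x ∈ (chartAt (Eucl n) p).source) (c d : Eucl n) :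
    coordMetric g p (extChartAt (𝓡 n) p x) c d = g.inner x (ofCoord p x c) (ofCoord p x d) := by
  change g.inner ((extChartAt (𝓡 n) p).symm (extChartAt (𝓡 n) p x)) _ _ = _
  rw [(extChartAt (𝓡 n) p).left_inv (by simpa using hx)]

omit [IsManifold (𝓡 n) ∞ M] in
theorem coordEndo_apply (B : EndField n M) (hx : x ∈ (chartAt (Eucl n) p).source) (c : Eucl n) :
    coordEndo B p (extChartAt (𝓡 n) p x) c = toCoord p x (B x (ofCoord p x c)) := by
  change toCoord p ((extChartAt (𝓡 n) p).symm (extChartAt (𝓡 n) p x)) (B _ _) = _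
  rw [(extChartAt (𝓡 n) p).left_inv (by simpa using hx)]
  rfl

theorem inner_lift (g : RMetric n M) (hx : x ∈ (chartAt (Eucl n) p).source)
    (V W : Eucl n → Eucl n) :
    g.inner x (lift p V x) (lift p W x) = coordMetric g p (extChartAt (𝓡 n) p x)
      (V (extChartAt (𝓡 n) p x)) (W (extChartAt (𝓡 n) p x)) :=
  (coordMetric_apply g hx _ _).symm

theorem contDiffOn_coordMetric (g : RMetric n M) (p : M) :
    ContDiffOn ℝ ∞ (coordMetric g p) (extChartAt (𝓡 n) p).target := by
  rw [contDiffOn_clm_apply]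
  intro c
  rw [contDiffOn_clm_apply]
  intro d
  refine contDiffOn_comp_extChartAt_symm
    (f := fun z ↦ g.inner z (lift p (fun _ ↦ c) z) (lift p (fun _ ↦ d) z)) fun x hx ↦ ?_
  let : RiemannianBundle (fun x : M ↦ TangentSpace (𝓡 n) x) := ⟨g.toRiemannianMetric⟩
  have : IsContMDiffRiemannianBundle (𝓡 n) ∞ (Eucl n) (fun x : M ↦ TangentSpace (𝓡 n) x) :=
    ⟨g.inner, g.contMDiff, fun _ _ _ ↦ rfl⟩
  exact ContMDiffAt.inner_bundle (F := Eucl n) (E := fun x : M ↦ TangentSpace (𝓡 n) x)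
    (smoothAt_lift hx contDiffAt_const) (smoothAt_lift hx contDiffAt_const)

theorem smoothAt_app {B : EndField n M} (hB : B.IsSmooth) {X : VField n M} (hX : SmoothAt X x) :
    SmoothAt (B.app X) x :=
  ContMDiffAt.clm_bundle_apply (hB x) hX

theorem contDiffOn_coordEndo {B : EndField n M} (hB : B.IsSmooth) (p : M) :
    ContDiffOn ℝ ∞ (coordEndo B p) (extChartAt (𝓡 n) p).target := by
  rw [contDiffOn_clm_apply]
  intro c
  exact contDiffOn_comp_extChartAt_symm (f := fun z ↦ toCoord p z (B.app (lift p fun _ ↦ c) z))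
    fun x hx ↦ (smoothAt_app hB (smoothAt_lift hx contDiffAt_const)).contDiffAt_toCoord hx

omit [IsManifold (𝓡 n) ∞ M] in
theorem extChartAt_mem_target (hx : x ∈ (chartAt (Eucl n) p).source) :
    extChartAt (𝓡 n) p x ∈ (extChartAt (𝓡 n) p).target :=
  (extChartAt (𝓡 n) p).map_source (by simpa using hx)

theorem coordMetric_symm (g : RMetric n M) (p : M) (y c d : Eucl n) :
    coordMetric g p y c d = coordMetric g p y d c :=
  g.symm _ _ _

theorem coordMetric_pos (g : RMetric n M) {y : Eucl n} (hy : y ∈ (extChartAt (𝓡 n) p).target)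
    {c : Eucl n} (hc : c ≠ 0) : 0 < coordMetric g p y c c := by
  refine g.pos _ _ fun h ↦ hc ?_
  have hx : (extChartAt (𝓡 n) p).symm y ∈ (chartAt (Eucl n) p).source := by
    simpa using (extChartAt (𝓡 n) p).map_target hy
  rw [← toCoord_ofCoord hx c, h, map_zero]

theorem differentiableAt_coordMetric (g : RMetric n M) {y : Eucl n}
    (hy : y ∈ (extChartAt (𝓡 n) p).target) : DifferentiableAt ℝ (coordMetric g p) y :=
  ((contDiffOn_coordMetric g p).contDiffAt ((isOpen_extChartAt_target p).mem_nhds hy)).differentiableAt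
    (by simp)

theorem mvfderiv_inner_lift (g : RMetric n M) (hx : x ∈ (chartAt (Eucl n) p).source)
    {V W : Eucl n → Eucl n} (X : Eucl n → Eucl n)
    (hV : ContDiffAt ℝ ∞ V (extChartAt (𝓡 n) p x)) (hW : ContDiffAt ℝ ∞ W (extChartAt (𝓡 n) p x))
    {y : Eucl n} (hy : extChartAt (𝓡 n) p x = y) :
    mvfderiv (𝓡 n) (fun z ↦ g.inner z (lift p V z) (lift p W z)) x (lift p X x) =
      fderiv ℝ (coordMetric g p) y (X y) (V y) (W y)
        + coordMetric g p y (fderiv ℝ V y (X y)) (W y)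
        + coordMetric g p y (V y) (fderiv ℝ W y (X y)) := by
  subst hy
  have hG := (differentiableAt_coordMetric g (extChartAt_mem_target hx)).hasFDerivAt
  have hV' := (hV.differentiableAt (by simp)).hasFDerivAt
  have hW' := (hW.differentiableAt (by simp)).hasFDerivAt
  have hd := (hG.clm_apply hV').clm_apply hW'
  rw [mvfderiv_lift hx (fun z hz ↦ inner_lift g hz V W) hd.differentiableAt, hd.fderiv]
  simp
  ring

/-- The Levi-Civita connection in coordinates. -/
theorem leviCivita_lift (g : RMetric n M) (hx : x ∈ (chartAt (Eucl n) p).source)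
    {V W : Eucl n → Eucl n} (hV : ContDiffAt ℝ ∞ V (extChartAt (𝓡 n) p x))
    (hW : ContDiffAt ℝ ∞ W (extChartAt (𝓡 n) p x)) :
    nabla (leviCivita g) (lift p V) (lift p W) x =
      lift p (fun y ↦ fderiv ℝ W y (V y) + christoffel (coordMetric g p) y (V y) (W y)) x := by
  refine ext_inner g fun v ↦ ?_
  set e := toCoord p x v with he
  have hv : v = lift p (fun _ ↦ e) x := (ofCoord_toCoord hx v).symm
  have hc : ContDiffAt ℝ ∞ (fun _ : Eucl n ↦ e) (extChartAt (𝓡 n) p x) := contDiffAt_const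
  rw [hv, inner_lift g hx]
  refine (inner_leviCivitaFun g (smoothAt_lift hx hV).diffAt (smoothAt_lift hx hW).diffAt
    (smoothAt_lift hx hc).diffAt).trans ?_
  rw [koszul, mvfderiv_inner_lift g hx V hW hc rfl, mvfderiv_inner_lift g hx W hV hc rfl,
    mvfderiv_inner_lift g hx (fun _ ↦ e) hV hW rfl, mlieBracket_lift hx hV hW,
    mlieBracket_lift hx hV hc, mlieBracket_lift hx hW hc, inner_lift g hx, inner_lift g hx,
    inner_lift g hx]
  set y := extChartAt (𝓡 n) p x with hy
  have hyt : y ∈ (extChartAt (𝓡 n) p).target := extChartAt_mem_target hx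
  simp only [map_add, add_apply, metric_christoffel fun c hc ↦ coordMetric_pos g hyt hc]
  simp
  rw [coordMetric_symm g p y (V y)]
  ring

theorem nabla_congr (cov : Connection n M) {X Y Y' : VField n M} (hY' : DiffAt Y' x)
    (h : ∀ᶠ z in 𝓝 x, Y z = Y' z) : nabla cov X Y x = nabla cov X Y' x := by
  have hY : DiffAt Y x := by
    refine MDifferentiableAt.congr_of_eventuallyEq hY' ?_
    filter_upwards [h] with z hz
    rw [hz]
  exact congrArg (fun L ↦ L (X x))
    (cov.isCovariantDerivativeOn.congr_of_eventuallyEq hY hY' Filter.univ_mem h)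

theorem ofCoord_injective (hx : x ∈ (chartAt (Eucl n) p).source) {c d : Eucl n}
    (h : (ofCoord p x c : TangentSpace (𝓡 n) x) = ofCoord p x d) : c = d := by
  rw [← toCoord_ofCoord hx c, h, toCoord_ofCoord hx]

theorem contDiffAt_coordChristoffel (g : RMetric n M) (hx : x ∈ (chartAt (Eucl n) p).source) :
    ContDiffAt ℝ ∞ (christoffel (coordMetric g p)) (extChartAt (𝓡 n) p x) :=
  (contDiffOn_christoffel (isOpen_extChartAt_target p) (contDiffOn_coordMetric g p)
    fun _ hy _ hc ↦ coordMetric_pos g hy hc).contDiffAt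
      ((isOpen_extChartAt_target p).mem_nhds (extChartAt_mem_target hx))

theorem mlieBracket_lift_const (hx : x ∈ (chartAt (Eucl n) p).source) (c d : Eucl n) :
    mlieBracket (𝓡 n) (lift p (fun _ ↦ c) : VField n M) (lift p fun _ ↦ d) x = 0 := by
  rw [mlieBracket_lift hx contDiffAt_const contDiffAt_const]
  simp [lift]

theorem nabla_nabla_lift_const (g : RMetric n M) (hx : x ∈ (chartAt (Eucl n) p).source)
    (c d e : Eucl n) {y : Eucl n} (hy : extChartAt (𝓡 n) p x = y) :
    nabla (leviCivita g) (lift p fun _ ↦ c)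
        (nabla (leviCivita g) (lift p fun _ ↦ d) (lift p fun _ ↦ e)) x =
      ofCoord p x (fderiv ℝ (christoffel (coordMetric g p)) y c d e
        + christoffel (coordMetric g p) y c (christoffel (coordMetric g p) y d e)) := by
  subst hy
  have hΓ : ContDiffAt ℝ ∞ (fun y ↦ christoffel (coordMetric g p) y d e)
      (extChartAt (𝓡 n) p x) :=
    ((contDiffAt_coordChristoffel g hx).clm_apply contDiffAt_const).clm_apply contDiffAt_const
  rw [nabla_congr (leviCivita g) (smoothAt_lift hx hΓ).diffAt, leviCivita_lift g hx
    contDiffAt_const hΓ]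
  · have hd := ((contDiffAt_coordChristoffel g hx).differentiableAt (by simp)).hasFDerivAt
    have := (hd.clm_apply (hasFDerivAt_const d _)).clm_apply (hasFDerivAt_const e _)
    simp only [lift]
    rw [this.fderiv]
    simp
  · filter_upwards [(chartAt (Eucl n) p).open_source.mem_nhds hx] with z hz
    rw [leviCivita_lift g hz contDiffAt_const contDiffAt_const]
    simp [lift]

theorem curvature_lift_const (g : RMetric n M) (hx : x ∈ (chartAt (Eucl n) p).source)
    (c d e : Eucl n) {y : Eucl n} (hy : extChartAt (𝓡 n) p x = y) :
    curvature (leviCivita g) (lift p fun _ ↦ c) (lift p fun _ ↦ d) (lift p fun _ ↦ e) x =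
      ofCoord p x (fderiv ℝ (christoffel (coordMetric g p)) y c d e
        - fderiv ℝ (christoffel (coordMetric g p)) y d c e
        + christoffel (coordMetric g p) y c (christoffel (coordMetric g p) y d e)
        - christoffel (coordMetric g p) y d (christoffel (coordMetric g p) y c e)) := by
  have h0 : nabla (leviCivita g) (mlieBracket (𝓡 n) (lift p fun _ ↦ c) (lift p fun _ ↦ d))
      (lift p fun _ ↦ e) x = 0 := by
    rw [nabla, mlieBracket_lift_const hx, map_zero]
  simp only [curvature, Pi.sub_apply, h0, nabla_nabla_lift_const g hx _ _ _ hy, sub_zero]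
  rw [← map_sub]
  congr 1
  abel

theorem app_lift (B : EndField n M) (hx : x ∈ (chartAt (Eucl n) p).source) (d : Eucl n) :
    B.app (lift p fun _ ↦ d) x = lift p (fun y ↦ coordEndo B p y d) x := by
  simp only [lift, EndField.app, coordEndo_apply B hx, ofCoord_toCoord hx]

theorem nabla_app_lift_const (g : RMetric n M) {B : EndField n M} (hB : B.IsSmooth)
    (hx : x ∈ (chartAt (Eucl n) p).source) (c d : Eucl n) {y : Eucl n}
    (hy : extChartAt (𝓡 n) p x = y) :
    nabla (leviCivita g) (lift p fun _ ↦ c) (B.app (lift p fun _ ↦ d)) x =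
      ofCoord p x (fderiv ℝ (coordEndo B p) y c d
        + christoffel (coordMetric g p) y c (coordEndo B p y d)) := by
  subst hy
  have hb' := (contDiffOn_coordEndo hB p).contDiffAt
      ((isOpen_extChartAt_target p).mem_nhds (extChartAt_mem_target hx))
  have hb : ContDiffAt ℝ ∞ (fun y ↦ coordEndo B p y d) (extChartAt (𝓡 n) p x) :=
    hb'.clm_apply contDiffAt_const
  rw [nabla_congr (leviCivita g) (smoothAt_lift hx hb).diffAt, leviCivita_lift g hx
    contDiffAt_const hb]
  · have := ((hb'.differentiableAt (by simp)).hasFDerivAt).clm_apply (hasFDerivAt_const d _)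
    simp only [lift]
    rw [this.fderiv]
    simp
  · filter_upwards [(chartAt (Eucl n) p).open_source.mem_nhds hx] with z hz
    exact app_lift B hz d

/-- In coordinates, a solution of the Gauss-Codazzi equations at infinity is a local solution. -/
theorem SolvesGaussCodazziAtInfinity.isLocalSolution {g : RMetric n M} {B : EndField n M}
    (h : SolvesGaussCodazziAtInfinity g B) (hB : B.IsSmooth) (hBg : B.IsSelfAdjoint g) (p : M) :
    IsLocalSolution (extChartAt (𝓡 n) p).target (coordMetric g p)
      (christoffel (coordMetric g p)) (coordEndo B p) := by
  have hsymm := coordMetric_symm g p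
  have hmem : ∀ y ∈ (extChartAt (𝓡 n) p).target, ∃ x ∈ (chartAt (Eucl n) p).source,
      extChartAt (𝓡 n) p x = y := fun y hy ↦
    ⟨(extChartAt (𝓡 n) p).symm y, by simpa using (extChartAt (𝓡 n) p).map_target hy,
      (extChartAt (𝓡 n) p).right_inv hy⟩
  refine
    { contDiffOn_metric := contDiffOn_coordMetric g p
      contDiffOn_christoffel := contDiffOn_christoffel (isOpen_extChartAt_target p)
        (contDiffOn_coordMetric g p) fun _ hy _ hc ↦ coordMetric_pos g hy hc
      contDiffOn_endo := contDiffOn_coordEndo hB p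
      symm := fun y _ ↦ hsymm y
      pos := fun y hy c hc ↦ coordMetric_pos g hy hc
      compat := fun y hy ↦ christoffel_compat (differentiableAt_coordMetric g hy)
        (.of_forall hsymm) fun c hc ↦ coordMetric_pos g hy hc
      torsion_free := fun y hy ↦ christoffel_symm (differentiableAt_coordMetric g hy)
        (.of_forall hsymm)
      self_adjoint := ?_
      codazzi := ?_
      gauss := ?_ }
  · intro y hy c d
    obtain ⟨x, hx, rfl⟩ := hmem y hy
    rw [coordMetric_apply g hx, coordMetric_apply g hx, coordEndo_apply B hx,
      coordEndo_apply B hx, ofCoord_toCoord hx, ofCoord_toCoord hx]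
    exact hBg x _ _
  · intro y hy c d
    obtain ⟨x, hx, hxy⟩ := hmem y hy
    have h1 := h.codazzi x (lift p fun _ ↦ c) (lift p fun _ ↦ d)
      (smoothAt_lift hx contDiffAt_const) (smoothAt_lift hx contDiffAt_const)
    simp only [extCovDeriv, Pi.sub_apply, nabla_app_lift_const g hB hx _ _ hxy] at h1
    rw [EndField.app, mlieBracket_lift_const hx, map_zero, sub_zero, sub_eq_zero] at h1
    exact ofCoord_injective hx h1
  · intro y hy c d e
    obtain ⟨x, hx, hxy⟩ := hmem y hy
    apply (isInvertible_of_pos fun c hc ↦ coordMetric_pos g hy (c := c) hc).injective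
    ext w
    have h1 := h.gauss x (lift p fun _ ↦ c) (lift p fun _ ↦ d) (lift p fun _ ↦ e)
      (lift p fun _ ↦ w) (smoothAt_lift hx contDiffAt_const) (smoothAt_lift hx contDiffAt_const)
      (smoothAt_lift hx contDiffAt_const) (smoothAt_lift hx contDiffAt_const)
    have hII (a a' : Eucl n) : secondForm g B x (ofCoord p x a) (ofCoord p x a') =
        coordMetric g p y (coordEndo B p y a) a' := by
      rw [← hxy, coordMetric_apply g hx, coordEndo_apply B hx, ofCoord_toCoord hx]
      rfl
    rw [Rm, curvature_lift_const g hx _ _ _ hxy] at h1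
    simp only [lift, kulkarniNomizu, hII, ← coordMetric_apply g hx, hxy] at h1
    rw [h1]
    simp
    ring

end CoordinateTensors

section ConformalChart

theorem trans_mem_maximalAtlas {H M : Type*} [TopologicalSpace H] [TopologicalSpace M]
    [ChartedSpace H M] {G : StructureGroupoid H} {e : OpenPartialHomeomorph M H}
    (he : e ∈ G.maximalAtlas M) {ψ : OpenPartialHomeomorph H H} (hψ : ψ ∈ G) :
    e.trans ψ ∈ G.maximalAtlas M := by
  rw [mem_maximalAtlas_iff] at he ⊢
  intro e' he'
  obtain ⟨h1, h2⟩ := he e' he'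
  constructor
  · rw [OpenPartialHomeomorph.trans_symm_eq_symm_trans_symm, OpenPartialHomeomorph.trans_assoc]
    exact G.trans (G.symm hψ) h1
  · rw [← OpenPartialHomeomorph.trans_assoc]
    exact G.trans h2 hψ

/-- **Inverse function theorem**, restricted to an open set. -/
theorem exists_mem_contDiffGroupoid {E : Type*} [NormedAddCommGroup E] [NormedSpace ℝ E]
    [CompleteSpace E] {φ : E → E} {V : Set E} (hV : IsOpen V) (hφ : ContDiffOn ℝ ∞ φ V)
    (hinv : ∀ y ∈ V, (fderiv ℝ φ y).IsInvertible) {y₀ : E} (hy₀ : y₀ ∈ V) :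
    ∃ ψ ∈ contDiffGroupoid ∞ 𝓘(ℝ, E), y₀ ∈ ψ.source ∧ ψ.source ⊆ V ∧ ∀ y, ψ y = φ y := by
  have hd : ∀ y ∈ V, ContDiffAt ℝ ∞ φ y := fun y hy ↦ hφ.contDiffAt (hV.mem_nhds hy)
  have hf : ∀ y ∈ V, HasFDerivAt φ (fderiv ℝ φ y) y := fun y hy ↦
    ((hd y hy).differentiableAt (by simp)).hasFDerivAt
  obtain ⟨e, he⟩ := hinv y₀ hy₀
  have hfe : HasFDerivAt φ (e : E →L[ℝ] E) y₀ := he ▸ hf y₀ hy₀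
  let ψ₀ := (hd y₀ hy₀).toOpenPartialHomeomorph φ hfe (by simp)
  have hψ₀ : ∀ y, ψ₀ y = φ y := fun y ↦ rfl
  have hsub : (ψ₀.restr V).source ⊆ V := by
    rw [ψ₀.restr_source' V hV]
    exact Set.inter_subset_right
  refine ⟨ψ₀.restr V, ?_, ?_, hsub, hψ₀⟩
  · rw [contDiffGroupoid, mem_groupoid_of_pregroupoid]
    refine ⟨?_, ?_⟩
    · simp only [contDiffPregroupoid, modelWithCornersSelf_coe,
        modelWithCornersSelf_coe_symm, Function.id_comp, Function.comp_id, Set.range_id,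
        Set.inter_univ, Set.preimage_id]
      exact hφ.mono hsub
    · simp only [contDiffPregroupoid, modelWithCornersSelf_coe,
        modelWithCornersSelf_coe_symm, Function.id_comp, Function.comp_id, Set.range_id,
        Set.inter_univ, Set.preimage_id]
      intro z hz
      have hzV : (ψ₀.restr V).symm z ∈ V := hsub ((ψ₀.restr V).map_target hz)
      obtain ⟨e', he'⟩ := hinv _ hzV
      exact ((ψ₀.restr V).contDiffAt_symm hz (f₀' := e')
        (by rw [he']; exact hf _ hzV) (hd _ hzV)).contDiffWithinAt
  · rw [ψ₀.restr_source' V hV]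
    exact ⟨(hd y₀ hy₀).mem_toOpenPartialHomeomorph_source hfe (by simp), hy₀⟩

variable {n : ℕ} {M : Type*} [TopologicalSpace M] [ChartedSpace (EuclideanSpace ℝ (Fin n)) M]
  [IsManifold (𝓡 n) ∞ M]

theorem SolvesGaussCodazziAtInfinity.isLocallyConformallyFlat {g : RMetric n M} {B : EndField n M}
    (h : SolvesGaussCodazziAtInfinity g B) (hB : B.IsSmooth) (hBg : B.IsSelfAdjoint g) :
    IsLocallyConformallyFlat g := by
  intro p
  obtain ⟨V, hVU, hVo, hpV, s, φ, hs, hφ, hspos, hconf⟩ :=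
    (h.isLocalSolution hB hBg p).exists_conformal_map (isOpen_extChartAt_target p)
      (extChartAt_mem_target (mem_chart_source (Eucl n) p))
  have hinv : ∀ y ∈ V, (fderiv ℝ φ y).IsInvertible := by
    intro y hy
    have hinj : Function.Injective (fderiv ℝ φ y).toLinearMap := by
      rw [injective_iff_map_eq_zero]
      intro c hc
      by_contra hc0
      have h1 := coordMetric_pos g (hVU hy) hc0
      have h2 : fderiv ℝ φ y c = 0 := hc
      simp [hconf y hy, h2] at h1
    exact ⟨(LinearEquiv.ofInjectiveEndo _ hinj).toContinuousLinearEquiv, by ext; rfl⟩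
  obtain ⟨ψ, hψG, hpψ, hψV, hψφ⟩ := exists_mem_contDiffGroupoid hVo hφ hinv hpV
  have hψφ' : (ψ : Eucl n → Eucl n) = φ := funext hψφ
  have hsrc : ∀ x ∈ ((chartAt (Eucl n) p).trans ψ).source,
      x ∈ (chartAt (Eucl n) p).source ∧ extChartAt (𝓡 n) p x ∈ V := by
    intro x hx
    rw [OpenPartialHomeomorph.trans_source] at hx
    exact ⟨hx.1, hψV hx.2⟩
  refine ⟨(chartAt (Eucl n) p).trans ψ,
    trans_mem_maximalAtlas (IsManifold.chart_mem_maximalAtlas p) hψG,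
    by rw [OpenPartialHomeomorph.trans_source]; exact ⟨mem_chart_source _ p, hpψ⟩,
    fun x ↦ Real.log (s (extChartAt (𝓡 n) p x)), fun x hx ↦ ?_, fun x hx v w ↦ ?_⟩
  · obtain ⟨hx1, hx2⟩ := hsrc x hx
    have h1 : ContDiffAt ℝ ∞ (fun y ↦ Real.log (s y)) (extChartAt (𝓡 n) p x) :=
      (hs.contDiffAt (hVo.mem_nhds hx2)).log (hspos _ hx2).ne'
    exact (h1.contMDiffAt.comp x (contMDiffAt_extChartAt' hx1)).contMDiffWithinAt
  · obtain ⟨hx1, hx2⟩ := hsrc x hx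
    have hder (v : TangentSpace (𝓡 n) x) :
        mfderiv (𝓡 n) 𝓘(ℝ, Eucl n) ((chartAt (Eucl n) p).trans ψ) x v =
          fderiv ℝ φ (extChartAt (𝓡 n) p x) (toCoord p x v) := by
      have e1 : ((chartAt (Eucl n) p).trans ψ : M → Eucl n) = φ ∘ extChartAt (𝓡 n) p := by
        rw [OpenPartialHomeomorph.coe_trans, hψφ']
        rfl
      have hφd : DifferentiableAt ℝ φ (extChartAt (𝓡 n) p x) :=
        (hφ.contDiffAt (hVo.mem_nhds hx2)).differentiableAt (by simp)
      rw [e1, mfderiv_comp_apply x hφd.mdifferentiableAt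
        ((contMDiffAt_extChartAt' (I := 𝓡 n) (n := ∞) hx1).mdifferentiableAt (by simp)),
        mfderiv_eq_fderiv]
      rfl
    have hexp : Real.exp (2 * Real.log (s (extChartAt (𝓡 n) p x))) =
        s (extChartAt (𝓡 n) p x) ^ 2 := by
      rw [two_mul, Real.exp_add, Real.exp_log (hspos _ hx2), sq]
    have key := hconf _ hx2 (toCoord p x v) (toCoord p x w)
    rw [coordMetric_apply g hx1, ofCoord_toCoord hx1, ofCoord_toCoord hx1] at key
    rw [key, hexp, ← hder, ← hder]
    rfl

end ConformalChart

end GCInfinity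
end

theorem proposition4p2 {n : ℕ} {M : Type*} [TopologicalSpace M]
    [ChartedSpace (EuclideanSpace ℝ (Fin n)) M] [IsManifold (𝓡 n) ∞ M]
    (g : GCInfinity.RMetric n M) (B : GCInfinity.EndField n M)
    (hB : B.IsSmooth) (hBg : B.IsSelfAdjoint g)
    (h : GCInfinity.SolvesGaussCodazziAtInfinity g B) :
    GCInfinity.IsLocallyConformallyFlat g :=
  h.isLocallyConformallyFlat hB hBg
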